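/- Let $N=2^n$ with $n\ge 0$. For $\theta\in[0,2\pi)^n$ define the simple scalar butterfly matrix $B(\theta)\in\mathbb R^{N\times N}$ recursively by $B()=[1]$ and $$B(\theta_1,\dots,\theta_{n})=\begin{bmatrix}\cos\theta_n\, I&\sin\theta_n\, I\\-\sin\theta_n\, I&\cos\theta_n\, I\end{bmatrix}\begin{bmatrix}A&0\\0&A\end{bmatrix},\qquad A=B(\theta_1,\dots,\theta_{n-1}).$$ A Haar-butterfly matrix $B\sim \mathrm B_s(N,\Sigma_S)$ is a random matrix with the law of $B(\theta)$, where $\theta_1,\dots,\theta_n$ are iid uniform on $[0,2\pi)$. For a matrix $A$ on which Gaussian elimination without pivoting (GENP) succeeds (no zero pivot is met in the elimination steps), let $A=LU$ be the resulting factorization ($L$ unit lower triangular, $U$ upper triangular), let $A^{(k)}$ be the matrix before the $k$-th step, so $A^{(1)}=A$ and $A^{(N)}=U$, and put $$\rho(A)=\frac{\|L\|_{\max}\max_k\|A^{(k)}\|_{\max}}{\|A\|_{\max}},\qquad \rho_o(A)=\frac{\|\,|L||U|\,\|_\infty}{\|A\|_\infty},\qquad \rho_\infty(A)=\frac{\|L\|_\infty\|U\|_\infty}{\|A\|_\infty},$$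 where $\|A\|_{\max}=\max_{i,j}|A_{ij}|$, $\|\cdot\|_\infty$ is the matrix norm induced by the $\ell_\infty$ norm, and $|\cdot|$ is taken entrywise. Partial pivoting (GEPP) uses in each step an entry of maximal modulus in the leading column of the active submatrix as pivot. Rook pivoting (GERP) starts from such an entry and moves alternately to an entry of maximal modulus in the current row and in the current column, until the current entry is maximal in modulus in both its row and its column of the active submatrix; this entry is the pivot. Ties may be broken in any way. If a pivoting strategy yields $PAQ=LU$ with permutation matrices $P,Q$, its growth factors are those of $PAQ$ without pivoting. **Theorem.** Let $B\sim \mathrm B_s(N,\Sigma_S)$, and let $X_1,\dots,X_n$ be iid standard Cauchy (density $\frac1{\pi(1+x^2)}$ on $\mathbb R$). Let $Y_j=|X_j|$ for GENP; for GEPP and GERP let $Y_1,\dots,Y_n$ be iid with the law of $|X_1|$ conditioned on $|X_1|\le 1$. 1. Almost surely GENP succeeds on $B$ and gives an $LU$ factorization of $B$. 2. Almost surely the GEPP factorization $PB=LU$ is unique (independent of the breaking of ties), and it is also the unique GERP factorization: GERP gives $PBQ=LU$ with the same $P,L,U$ and $Q=I$. 3. For GENP, GEPP and GERP, with the respective $Y_j$,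 the following equalities in distribution hold: $$\rho(B)\sim\prod_{j=1}^n(1+Y_j^2),\qquad \rho_o(B)\sim\prod_{j=1}^n\Big(1+\frac{2Y_j^2}{1+Y_j}\Big),\qquad \rho_\infty(B)\sim\prod_{j=1}^n\big(1+\max(Y_j,Y_j^2)\big).$$ 4. Almost surely, for GENP, $1\le\rho(B)\le\rho_\infty(B)$ and $1\le\rho_o(B)\le\rho_\infty(B)$; and for GEPP and for GERP, $1\le\rho(B)\le\rho_o(B)\le\rho_\infty(B)\le N$. 5. Almost surely, for all permutation matrices $P,Q$ (which may depend on $B$) such that GENP succeeds on $PBQ$, one has $\rho^{\mathrm{GENP}}(PBQ)\ge\rho^{\mathrm{GEPP}}(B)$. -/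

import Mathlib

open MeasureTheory ProbabilityTheory

/-! ## Butterfly matrices -/

/-- The butterfly step: from `m × m` matrices `C`, `S`, `A₁`, `A₂`, the `(m + m) × (m + m)` matrix
`[[C, S], [-S, C]] * [[A₁, 0], [0, A₂]]`. -/
def butterflyStep {m : ℕ} (C S A₁ A₂ : Matrix (Fin m) (Fin m) ℝ) :
    Matrix (Fin (m + m)) (Fin (m + m)) ℝ :=
  Matrix.reindex finSumFinEquiv finSumFinEquiv
    (Matrix.fromBlocks C S (-S) C * Matrix.fromBlocks A₁ 0 0 A₂)

theorem two_pow_add_two_pow (n : ℕ) : 2 ^ n + 2 ^ n = 2 ^ (n + 1) := by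
  rw [pow_succ]; ring

/-- The simple scalar butterfly matrix `B(θ)` of dimension `2 ^ n`. The angle `θ j` is the one
introduced in the `(j+1)`-st recursive step, so the outermost step uses the last angle. -/
noncomputable def butterfly : (n : ℕ) → (Fin n → ℝ) → Matrix (Fin (2 ^ n)) (Fin (2 ^ n)) ℝ
  | 0, _ => 1
  | n + 1, θ =>
    let A := butterfly n (fun j => θ j.castSucc)
    let c := Real.cos (θ (Fin.last n))
    let s := Real.sin (θ (Fin.last n))
    Matrix.reindex (finCongr (two_pow_add_two_pow n)) (finCongr (two_pow_add_two_pow n))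
      (butterflyStep (c • 1) (s • 1) A A)

/-- Entrywise (product, i.e. Borel) measurable structure on real matrices. -/
instance matrixMeasurableSpace {m n : Type*} : MeasurableSpace (Matrix m n ℝ) :=
  inferInstanceAs (MeasurableSpace (m → n → ℝ))

/-- The uniform distribution on `[0, 2π)`. -/
noncomputable def uniformAngle : Measure ℝ :=
  ProbabilityTheory.cond volume (Set.Ico 0 (2 * Real.pi))

/-- The law of a Haar-butterfly matrix of dimension `2 ^ n`: the law of `B(θ)` for
`θ` with iid uniform coordinates on `[0, 2π)`. -/
noncomputable def haarButterfly (n : ℕ) : Measure (Matrix (Fin (2 ^ n)) (Fin (2 ^ n)) ℝ) :=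
  (Measure.pi fun _ : Fin n => uniformAngle).map (butterfly n)

/-- The law of `|X|` conditionally on `|X| ≤ 1`, for `X` standard Cauchy. -/
noncomputable def condAbsCauchy : Measure ℝ :=
  (ProbabilityTheory.cond (cauchyMeasure 0 1) {x : ℝ | |x| ≤ 1}).map (fun x => |x|)

/-! ## Matrix norms -/

/-- The elementwise maximum norm `max |A i j|`. -/
noncomputable def maxNorm {m : ℕ} (A : Matrix (Fin m) (Fin m) ℝ) : ℝ :=
  ⨆ i, ⨆ j, |A i j|

/-- The matrix norm induced by the `ℓ_∞` vector norm. -/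
noncomputable def linfNorm {m : ℕ} (A : Matrix (Fin m) (Fin m) ℝ) : ℝ :=
  letI : NormedAddCommGroup (Matrix (Fin m) (Fin m) ℝ) := Matrix.linftyOpNormedAddCommGroup
  ‖A‖

/-! ## Gaussian elimination without pivoting -/

/-- Elimination below the diagonal in column `k`, with pivot `A k k`. -/
noncomputable def geStep {m : ℕ} (k : Fin m) (A : Matrix (Fin m) (Fin m) ℝ) :
    Matrix (Fin m) (Fin m) ℝ :=
  Matrix.of fun i j => if k < i then A i j - A i k / A k k * A k j else A i j

/-- `geIter A k` is the matrix obtained after `k` elimination steps, i.e. the matrix before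
the step with (0-based) number `k`; the usual `A^(k)` is `geIter A (k - 1)`. -/
noncomputable def geIter {m : ℕ} (A : Matrix (Fin m) (Fin m) ℝ) : ℕ → Matrix (Fin m) (Fin m) ℝ
  | 0 => A
  | k + 1 => if h : k < m then geStep ⟨k, h⟩ (geIter A k) else geIter A k

/-- Elimination without pivoting runs to completion: in none of the `m - 1` elimination steps
is the pivot zero. -/
def GENPDefined {m : ℕ} (A : Matrix (Fin m) (Fin m) ℝ) : Prop :=
  ∀ k : Fin m, (k : ℕ) + 1 < m → geIter A k k k ≠ 0

/-- The lower triangular factor: unit diagonal, and below it the multipliers. -/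
noncomputable def genpL {m : ℕ} (A : Matrix (Fin m) (Fin m) ℝ) : Matrix (Fin m) (Fin m) ℝ :=
  Matrix.of fun i j =>
    if i = j then 1 else if j < i then geIter A j i j / geIter A j j j else 0

/-- The upper triangular factor: the result of the `m - 1` elimination steps. -/
noncomputable def genpU {m : ℕ} (A : Matrix (Fin m) (Fin m) ℝ) : Matrix (Fin m) (Fin m) ℝ :=
  geIter A (m - 1)

/-- `A = L * U` with `L` unit lower triangular and `U` upper triangular. -/
structure IsLU {m : ℕ} (A L U : Matrix (Fin m) (Fin m) ℝ) : Prop where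
  diag_one : ∀ i, L i i = 1
  lower : ∀ i j, i < j → L i j = 0
  upper : ∀ i j, j < i → U i j = 0
  eq_mul : A = L * U

/-! ## Growth factors (of elimination without pivoting) -/

/-- The max-norm growth factor `ρ(A) = ‖L‖_max * max_k ‖A^(k)‖_max / ‖A‖_max`. -/
noncomputable def rhoMax {m : ℕ} (A : Matrix (Fin m) (Fin m) ℝ) : ℝ :=
  maxNorm (genpL A) * (⨆ k : Fin m, maxNorm (geIter A k)) / maxNorm A

/-- The growth factor `ρ_o(A) = ‖ |L| |U| ‖_∞ / ‖A‖_∞`. -/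
noncomputable def rhoO {m : ℕ} (A : Matrix (Fin m) (Fin m) ℝ) : ℝ :=
  linfNorm ((genpL A).map (fun x => |x|) * (genpU A).map (fun x => |x|)) / linfNorm A

/-- The growth factor `ρ_∞(A) = ‖L‖_∞ * ‖U‖_∞ / ‖A‖_∞`. -/
noncomputable def rhoInf {m : ℕ} (A : Matrix (Fin m) (Fin m) ℝ) : ℝ :=
  linfNorm (genpL A) * linfNorm (genpU A) / linfNorm A

/-! ## Gaussian elimination with pivoting

A pivot sequence `p` gives, for each step `k`, the position `p k` (row, column) in the current
matrix of the entry that is moved to position `(k, k)` before elimination in column `k`. -/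

/-- The current matrix before step `k` (before its row and column interchange). -/
noncomputable def workMat {m : ℕ} (A : Matrix (Fin m) (Fin m) ℝ) (p : Fin m → Fin m × Fin m) :
    ℕ → Matrix (Fin m) (Fin m) ℝ
  | 0 => A
  | k + 1 =>
    if h : k < m then
      geStep ⟨k, h⟩ ((workMat A p k).submatrix
        (Equiv.swap ⟨k, h⟩ (p ⟨k, h⟩).1) (Equiv.swap ⟨k, h⟩ (p ⟨k, h⟩).2))
    else workMat A p k

/-- The product of the interchanges `(0 r₀) (1 r₁) ⋯` of the first `k` steps. -/
def interchanges {m : ℕ} (r : Fin m → Fin m) : ℕ → Equiv.Perm (Fin m)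
  | 0 => 1
  | k + 1 => if h : k < m then interchanges r k * Equiv.swap ⟨k, h⟩ (r ⟨k, h⟩)
    else interchanges r k

/-- The row permutation matrix `P` of an elimination with pivot sequence `p`;
`(P * A) i j = A (σ i) j` for `σ` the product of the row interchanges. -/
def rowPermMatrix {m : ℕ} (p : Fin m → Fin m × Fin m) : Matrix (Fin m) (Fin m) ℝ :=
  (interchanges (fun k => (p k).1) m).permMatrix ℝ

/-- The column permutation matrix `Q` of an elimination with pivot sequence `p`;
`(A * Q) i j = A i (τ j)` for `τ` the product of the column interchanges. -/
def colPermMatrix {m : ℕ} (p : Fin m → Fin m × Fin m) : Matrix (Fin m) (Fin m) ℝ :=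
  (interchanges (fun k => (p k).2) m)⁻¹.permMatrix ℝ

/-- The permuted matrix `P * A * Q`, whose `LU` factorization without pivoting is the
factorization `P * A * Q = L * U` computed with the pivot sequence `p`. -/
def pivoted {m : ℕ} (A : Matrix (Fin m) (Fin m) ℝ) (p : Fin m → Fin m × Fin m) :
    Matrix (Fin m) (Fin m) ℝ :=
  rowPermMatrix p * A * colPermMatrix p

/-- In the active submatrix (rows and columns `≥ k`), the entry `(i, j)` has maximal
modulus in its column. -/
def IsColMax {m : ℕ} (W : Matrix (Fin m) (Fin m) ℝ) (k i j : Fin m) : Prop :=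
  k ≤ i ∧ k ≤ j ∧ ∀ i', k ≤ i' → |W i' j| ≤ |W i j|

/-- In the active submatrix (rows and columns `≥ k`), the entry `(i, j)` has maximal
modulus in its row. -/
def IsRowMax {m : ℕ} (W : Matrix (Fin m) (Fin m) ℝ) (k i j : Fin m) : Prop :=
  k ≤ i ∧ k ≤ j ∧ ∀ j', k ≤ j' → |W i j'| ≤ |W i j|

/-- The positions visited by a rook pivot search in the active submatrix: it starts at an entry of
maximal modulus in the leading column, and as long as the current entry is not maximal in
both its row and its column it moves to a maximal entry of that row, resp. of that column. -/
inductive RookVisits {m : ℕ} (W : Matrix (Fin m) (Fin m) ℝ) (k : Fin m) : Fin m → Fin m → Prop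
  | start (i : Fin m) : IsColMax W k i k → RookVisits W k i k
  | alongRow (i j j' : Fin m) : RookVisits W k i j → ¬ IsRowMax W k i j → IsRowMax W k i j' →
      RookVisits W k i j'
  | alongCol (i i' j : Fin m) : RookVisits W k i j → ¬ IsColMax W k i j → IsColMax W k i' j →
      RookVisits W k i' j

/-- The two pivoting strategies: GEPP (partial pivoting) and GERP (rook pivoting). -/
inductive PivotStrategy
  | partialPivoting
  | rookPivoting

/-- The positions that the strategy may choose as pivot in step `k`, for the current matrix `W`
(ties may be broken in any way). -/
def PivotStrategy.Admissible : PivotStrategy → {m : ℕ} → Matrix (Fin m) (Fin m) ℝ → Fin m →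
    Fin m × Fin m → Prop
  | partialPivoting, _, W, k, q => q.2 = k ∧ IsColMax W k q.1 k
  | rookPivoting, _, W, k, q =>
      RookVisits W k q.1 q.2 ∧ IsRowMax W k q.1 q.2 ∧ IsColMax W k q.1 q.2

/-- `p` is a pivot sequence produced by the strategy on the matrix `A`. -/
def PivotStrategy.IsRun (s : PivotStrategy) {m : ℕ} (A : Matrix (Fin m) (Fin m) ℝ)
    (p : Fin m → Fin m × Fin m) : Prop :=
  ∀ k : Fin m, s.Admissible (workMat A p k) k (p k)

/-- `P * A * Q = L * U` is a factorization produced by the strategy on the matrix `A`. -/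
def PivotStrategy.Factors (s : PivotStrategy) {m : ℕ}
    (A P Q L U : Matrix (Fin m) (Fin m) ℝ) : Prop :=
  ∃ p, s.IsRun A p ∧ P = rowPermMatrix p ∧ Q = colPermMatrix p ∧
    L = genpL (pivoted A p) ∧ U = genpU (pivoted A p)

/-! ## Norms -/

/-! The butterfly recursion is a Kronecker product of plane rotations (`butterfly_eq_kron`). A 2 × 2
orthogonal matrix with first row `(a, b)`, `a ≠ 0`, has explicit triangular factors, and Kronecker
products respect multiplication, triangularity, entrywise modulus and both norms. Hence the LU
factors are Kronecker products, and the growth factors are products over `k` of functions of `|b_k /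
a_k|`, which is `|tan θ_k|` without pivoting. The one quantity that does not factor by itself is
`max_k ‖A^(k)‖_max`: the entries of `A^(k)` are entries of `U` or tails of the sum `L * U`. An
induction over the factors (`abs_partial_sum_kron_rot_le`) bounds them by the last pivot `∏ 1 /
|a_k|`, which `U` attains.

Almost surely no angle is a multiple of `π / 4`. Swapping the rows of each factor with `|sin| >
|cos|` gives `|b_k| < |a_k|` throughout; then all multipliers are strictly below one and each pivot
is maximal in its row of `U`. Partial and rook pivoting therefore have a single choice at every step
(`IsDominantLU.admissible_workMat_iff`), and `|tan θ_k|` is replaced by `min |tan θ_k| |tan θ_k|⁻¹`.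

The tangent of a uniform angle has the modulus of a Cauchy variable `X`; as `1 / X` is again Cauchy,
`min |X| |X|⁻¹` has the law of `|X|` given `|X| ≤ 1`. The inequalities hold factor by factor. For
minimality, the last pivot of an orthogonal `A` is the inverse of its last diagonal entry, so the
growth is at least `‖A‖_max⁻²`. This bound ignores permutations and is attained after partial
pivoting. -/

theorem abs_le_maxNorm {m : ℕ} (A : Matrix (Fin m) (Fin m) ℝ) (i j : Fin m) :
    |A i j| ≤ maxNorm A :=
  (le_ciSup (f := fun j => |A i j|) (Set.finite_range _).bddAbove j).trans
    (le_ciSup (f := fun i => ⨆ j, |A i j|) (Set.finite_range _).bddAbove i)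

theorem maxNorm_le {m : ℕ} {A : Matrix (Fin m) (Fin m) ℝ} {x : ℝ} (hx : 0 ≤ x)
    (h : ∀ i j, |A i j| ≤ x) : maxNorm A ≤ x :=
  Real.iSup_le (fun i => Real.iSup_le (h i) hx) hx

theorem maxNorm_eq {m : ℕ} {A : Matrix (Fin m) (Fin m) ℝ} {x : ℝ}
    (h : ∀ i j, |A i j| ≤ x) (i j : Fin m) (hij : |A i j| = x) : maxNorm A = x :=
  le_antisymm (maxNorm_le (hij ▸ abs_nonneg _) h) (hij ▸ abs_le_maxNorm A i j)

theorem exists_abs_eq_maxNorm {m : ℕ} [NeZero m] (A : Matrix (Fin m) (Fin m) ℝ) :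
    ∃ i j, |A i j| = maxNorm A := by
  obtain ⟨⟨i, j⟩, h⟩ := Finite.exists_max (fun q : Fin m × Fin m => |A q.1 q.2|)
  exact ⟨i, j, (maxNorm_eq (fun i' j' => h (i', j')) i j rfl).symm⟩

theorem linfNorm_eq_iSup {m : ℕ} (A : Matrix (Fin m) (Fin m) ℝ) :
    linfNorm A = ((Finset.univ.sup fun i => ∑ j, ‖A i j‖₊ : NNReal) : ℝ) :=
  Matrix.linfty_opNorm_def A

theorem rowSum_le_linfNorm {m : ℕ} (A : Matrix (Fin m) (Fin m) ℝ) (i : Fin m) :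
    ∑ j, |A i j| ≤ linfNorm A := by
  rw [linfNorm_eq_iSup]
  have h := Finset.le_sup (f := fun i => ∑ j, ‖A i j‖₊) (Finset.mem_univ i)
  have h' := NNReal.coe_le_coe.2 h
  simpa using h'

theorem linfNorm_eq {m : ℕ} {A : Matrix (Fin m) (Fin m) ℝ} {x : ℝ}
    (h : ∀ i, ∑ j, |A i j| ≤ x) (i : Fin m) (hi : ∑ j, |A i j| = x) : linfNorm A = x := by
  refine le_antisymm ?_ (hi ▸ rowSum_le_linfNorm A i)
  have hx : 0 ≤ x := hi ▸ Finset.sum_nonneg fun _ _ => abs_nonneg _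
  lift x to NNReal using hx
  rw [linfNorm_eq_iSup, NNReal.coe_le_coe]
  refine Finset.sup_le fun i _ => ?_
  rw [← NNReal.coe_le_coe]
  simpa using h i

theorem exists_rowSum_eq_linfNorm {m : ℕ} [NeZero m] (A : Matrix (Fin m) (Fin m) ℝ) :
    ∃ i, ∑ j, |A i j| = linfNorm A := by
  obtain ⟨i, h⟩ := Finite.exists_max (fun i : Fin m => ∑ j, |A i j|)
  exact ⟨i, (linfNorm_eq h i rfl).symm⟩

theorem permMatrix_mul_mul_permMatrix_apply {m : ℕ} (A : Matrix (Fin m) (Fin m) ℝ)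
    (σ τ : Equiv.Perm (Fin m)) :
    σ.permMatrix ℝ * A * τ.permMatrix ℝ = A.submatrix σ τ.symm := by
  ext i j
  simp [Equiv.Perm.permMatrix, PEquiv.toMatrix_toPEquiv_mul, PEquiv.mul_toMatrix_toPEquiv]

theorem maxNorm_submatrix {m : ℕ} (A : Matrix (Fin m) (Fin m) ℝ) (σ τ : Equiv.Perm (Fin m)) :
    maxNorm (A.submatrix σ τ) = maxNorm A := by
  unfold maxNorm
  simp only [Matrix.submatrix_apply]
  rw [σ.iSup_comp (g := fun i => ⨆ j, |A i (τ j)|)]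
  congr 1
  ext i
  exact τ.iSup_comp (g := fun j => |A i j|)

/-! ## Elimination in terms of the factors -/

theorem geIter_succ_apply {m : ℕ} (A : Matrix (Fin m) (Fin m) ℝ) {k : ℕ} (h : k < m)
    (i j : Fin m) :
    geIter A (k + 1) i j = if (⟨k, h⟩ : Fin m) < i then
      geIter A k i j - geIter A k i ⟨k, h⟩ / geIter A k ⟨k, h⟩ ⟨k, h⟩ * geIter A k ⟨k, h⟩ j
      else geIter A k i j := by
  simp [geIter, h, geStep]

/-- The pivots of an upper triangular factor, except possibly the last one, are nonzero. -/
def PivotsNeZero {m : ℕ} (U : Matrix (Fin m) (Fin m) ℝ) : Prop :=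
  ∀ k : Fin m, (k : ℕ) + 1 < m → U k k ≠ 0

section IsLU

variable {m : ℕ} {A L U : Matrix (Fin m) (Fin m) ℝ}

theorem IsLU.tail_sum_row (h : IsLU A L U) (i j : Fin m) :
    ∑ l with i ≤ l, L i l * U l j = U i j := by
  rw [Finset.sum_eq_single_of_mem i (by simp)]
  · simp [h.diag_one]
  · intro l hl hne
    rw [h.lower i l (lt_of_le_of_ne (by simpa using hl) hne.symm), zero_mul]

theorem IsLU.tail_sum_col (h : IsLU A L U) (i j : Fin m) :
    ∑ l with j ≤ l, L i l * U l j = L i j * U j j := by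
  rw [Finset.sum_eq_single_of_mem j (by simp)]
  intro l hl hne
  rw [h.upper l j (lt_of_le_of_ne (by simpa using hl) hne.symm), mul_zero]

/-- Step `k` subtracts the outer product of column `k` of `L` and row `k` of `U` from the rows below
`k`. Unfinished rows thus hold the remaining outer products, and finished rows are rows of `U`. The
last pivot is never divided by, so it may vanish. -/
theorem IsLU.geIter_eq (h : IsLU A L U) (hU : PivotsNeZero U) :
    ∀ k : ℕ, k ≤ m → ∀ i j : Fin m,
      geIter A k i j = if (i : ℕ) < k then U i j else ∑ l : Fin m with k ≤ l.val, L i l * U l j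
  | 0, _, i, j => by
    simp [geIter, h.eq_mul, Matrix.mul_apply]
  | k + 1, hk, i, j => by
    have hk' : k < m := hk
    have ih := h.geIter_eq hU k hk'.le
    set κ : Fin m := ⟨k, hk'⟩ with hκ
    have hle : ∀ l : Fin m, k ≤ (l : ℕ) ↔ κ ≤ l := fun l => Iff.rfl
    rw [geIter_succ_apply A hk']
    by_cases hi : κ < i
    · have hi1 : ¬ (i : ℕ) < k := not_lt.2 (le_of_lt hi)
      have hi2 : ¬ (i : ℕ) < k + 1 := not_lt.2 hi
      have hne : U κ κ ≠ 0 := hU κ (lt_of_le_of_lt (Nat.succ_le_of_lt hi) i.2)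
      rw [if_pos hi, ih i j, ih i κ, ih κ κ, ih κ j, if_neg hi1, if_neg hi1,
        if_neg (lt_irrefl k), if_neg (lt_irrefl k), if_neg hi2]
      simp only [hle]
      rw [h.tail_sum_col, h.tail_sum_row, h.tail_sum_row, mul_div_cancel_right₀ _ hne,
        sub_eq_iff_eq_add]
      have : (Finset.univ.filter fun l : Fin m => κ ≤ l)
          = insert κ (Finset.univ.filter fun l : Fin m => k + 1 ≤ (l : ℕ)) := by
        ext l
        simp only [Finset.mem_filter, Finset.mem_univ, true_and, Finset.mem_insert,
          Fin.ext_iff, Fin.le_def, hκ]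
        omega
      rw [this, Finset.sum_insert (by simp [hκ]), add_comm]
    · have hi' : (i : ℕ) ≤ k := not_lt.1 hi
      rw [if_neg hi, ih i j, if_pos (Nat.lt_succ_of_le hi')]
      rcases hi'.lt_or_eq with h1 | h1
      · rw [if_pos h1]
      -- Row `κ` has just become final: its tail sum collapses to row `κ` of `U`, because `L` is
      -- unit lower triangular.
      · rw [if_neg (by omega)]
        have : i = κ := Fin.ext h1
        subst this
        exact h.tail_sum_row _ j

theorem IsLU.geIter_col (h : IsLU A L U) (hU : PivotsNeZero U) (i k : Fin m) (hki : k ≤ i) :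
    geIter A k i k = L i k * U k k := by
  rw [h.geIter_eq hU k k.2.le, if_neg (not_lt.2 (Fin.le_def.1 hki))]
  exact h.tail_sum_col i k

theorem IsLU.geIter_row (h : IsLU A L U) (hU : PivotsNeZero U) (k j : Fin m) :
    geIter A k k j = U k j := by
  rw [h.geIter_eq hU k k.2.le, if_neg (lt_irrefl _)]
  exact h.tail_sum_row k j

theorem IsLU.genpDefined (h : IsLU A L U) (hU : PivotsNeZero U) : GENPDefined A :=
  fun k hk => by rw [h.geIter_row hU]; exact hU k hk

theorem IsLU.genpL_eq (h : IsLU A L U) (hU : PivotsNeZero U) : genpL A = L := by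
  ext i j
  simp only [genpL, Matrix.of_apply]
  split_ifs with h1 h2
  · rw [h1, h.diag_one]
  · rw [h.geIter_col hU i j h2.le, h.geIter_row hU,
      mul_div_cancel_right₀ _ (hU j (lt_of_le_of_lt (Nat.succ_le_of_lt h2) i.2))]
  · rw [h.lower i j (lt_of_le_of_ne (not_lt.1 h2) h1)]

theorem IsLU.genpU_eq (h : IsLU A L U) (hU : PivotsNeZero U) : genpU A = U := by
  ext i j
  rw [genpU, h.geIter_eq hU _ (Nat.sub_le _ _)]
  split_ifs with h1
  · rfl
  -- Only the last row is left, and there `m - 1 ≤ l` and `i ≤ l` are the same condition.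
  · rw [← h.tail_sum_row i j]
    refine Finset.sum_congr (Finset.filter_congr fun l _ => ?_) fun _ _ => rfl
    rw [Fin.le_def]
    omega

end IsLU

/-! ## Elimination without pivoting yields the factors -/

theorem GENPDefined.geIter_lower {m : ℕ} {A : Matrix (Fin m) (Fin m) ℝ} (h : GENPDefined A) :
    ∀ k : ℕ, k ≤ m → ∀ i j : Fin m, (j : ℕ) < k → j < i → geIter A k i j = 0
  | k + 1, hk, i, j, hj, hji => by
    have hk' : k < m := hk
    rw [geIter_succ_apply A hk']
    rcases (Nat.lt_succ_iff.1 hj).lt_or_eq with h1 | h1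
    · rw [h.geIter_lower k hk'.le i j h1 hji, h.geIter_lower k hk'.le ⟨k, hk'⟩ j h1 h1]
      simp
    · have : j = ⟨k, hk'⟩ := Fin.ext h1
      subst this
      rw [if_pos hji, div_mul_cancel₀, sub_self]
      exact h ⟨k, hk'⟩ (lt_of_le_of_lt (Nat.succ_le_of_lt hji) i.2)

/-- Each step subtracts exactly the multiple of the pivot row that `genpL` records, and the rows `l
< k` no longer change. This needs no condition on the pivots, since both sides use the same quotient
even when it is a division by zero. -/
theorem geIter_add_eq {m : ℕ} (A : Matrix (Fin m) (Fin m) ℝ) :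
    ∀ k : ℕ, k ≤ m → ∀ i j : Fin m,
      A i j = ∑ l : Fin m with l.val < k ∧ l < i, genpL A i l * geIter A k l j + geIter A k i j
  | 0, _, i, j => by simp [geIter]
  | k + 1, hk, i, j => by
    have hk' : k < m := hk
    set κ : Fin m := ⟨k, hk'⟩ with hκ
    have hrow : ∀ l : Fin m, (l : ℕ) ≤ k → geIter A (k + 1) l j = geIter A k l j := fun l hl => by
      rw [geIter_succ_apply A hk', if_neg (not_lt.2 (show l ≤ κ from hl))]
    have hsum : ∑ l : Fin m with l.val < k + 1 ∧ l < i, genpL A i l * geIter A (k + 1) l j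
        = ∑ l : Fin m with l.val < k + 1 ∧ l < i, genpL A i l * geIter A k l j :=
      Finset.sum_congr rfl fun l hl => by
        rw [hrow l (Nat.lt_succ_iff.1 (Finset.mem_filter.1 hl).2.1)]
    rw [hsum, geIter_add_eq A k hk'.le i j]
    by_cases hi : κ < i
    · have : (Finset.univ.filter fun l : Fin m => (l : ℕ) < k + 1 ∧ l < i)
          = insert κ (Finset.univ.filter fun l : Fin m => (l : ℕ) < k ∧ l < i) := by
        ext l
        simp only [Finset.mem_filter, Finset.mem_univ, true_and, Finset.mem_insert,
          Fin.ext_iff, Fin.lt_def, hκ] at hi ⊢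
        omega
      rw [this, Finset.sum_insert (by simp [hκ]), geIter_succ_apply A hk', if_pos hi]
      have hL : genpL A i κ = geIter A k i κ / geIter A k κ κ := by
        simp only [genpL, Matrix.of_apply, if_neg hi.ne', if_pos hi]
        rfl
      rw [hL]
      ring
    · have : (Finset.univ.filter fun l : Fin m => (l : ℕ) < k + 1 ∧ l < i)
          = (Finset.univ.filter fun l : Fin m => (l : ℕ) < k ∧ l < i) := by
        ext l
        simp only [Finset.mem_filter, Finset.mem_univ, true_and, Fin.lt_def, hκ] at hi ⊢
        omega
      rw [this, hrow i (not_lt.1 hi)]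

theorem GENPDefined.isLU {m : ℕ} {A : Matrix (Fin m) (Fin m) ℝ} (h : GENPDefined A) :
    IsLU A (genpL A) (genpU A) where
  diag_one i := by simp [genpL]
  lower i j hij := by simp [genpL, hij.ne, hij.not_gt]
  upper i j hij := h.geIter_lower _ (Nat.sub_le _ _) i j (by rw [Fin.lt_def] at hij; omega) hij
  eq_mul := by
    ext i j
    rw [geIter_add_eq A (m - 1) (Nat.sub_le _ _) i j, Matrix.mul_apply]
    -- The remainder after `m - 1` steps is the diagonal term `l = i` of `L * U`; the terms with `l
    -- > i` vanish.
    have hsub : (insert i (Finset.univ.filter fun l : Fin m => (l : ℕ) < m - 1 ∧ l < i))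
        ⊆ Finset.univ := Finset.subset_univ _
    rw [← Finset.sum_subset hsub, Finset.sum_insert (by simp), add_comm]
    · simp [genpL, genpU]
    · intro l _ hl
      have hil : i < l := by
        simp only [Finset.mem_insert, Finset.mem_filter, Finset.mem_univ, true_and, not_or,
          not_and, Fin.ext_iff, Fin.lt_def] at hl ⊢
        omega
      simp [genpL, hil.ne, hil.not_gt]

/-! ## A lower bound for the max-norm growth factor of orthogonal matrices -/

/-- In `U * V * L = 1` the last row of `U` and the last column of `L` each have only their diagonal
entry, so the last diagonal entry of the product is `U z z * V z z`. -/
theorem IsLU.last_pivot_mul_inv {m : ℕ} {A L U V : Matrix (Fin m) (Fin m) ℝ} (h : IsLU A L U)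
    (hV : A * V = 1) (z : Fin m) (hz : ∀ i, i ≤ z) : U z z * V z z = 1 := by
  have h1 : U * (V * L) = 1 := by
    rw [mul_eq_one_comm, Matrix.mul_assoc, ← h.eq_mul, mul_eq_one_comm, hV]
  have h2 := congrFun (congrFun h1 z) z
  rw [Matrix.one_apply_eq, Matrix.mul_apply, Finset.sum_eq_single z] at h2
  · rw [Matrix.mul_apply, Finset.sum_eq_single z] at h2
    · simpa [h.diag_one] using h2
    · intro l _ hl
      rw [h.lower l z (lt_of_le_of_ne (hz l) hl), mul_zero]
    · simp
  · intro l _ hl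
    rw [h.upper z l (lt_of_le_of_ne (hz l) hl), zero_mul]
  · simp

theorem maxNorm_geIter_le_iSup {m : ℕ} (A : Matrix (Fin m) (Fin m) ℝ) (k : Fin m) :
    maxNorm (geIter A k) ≤ ⨆ k : Fin m, maxNorm (geIter A k) :=
  le_ciSup (f := fun k : Fin m => maxNorm (geIter A k)) (Set.finite_range _).bddAbove k

/-- The inverse is the transpose, so the last pivot is `1 / A z z`, of modulus at least `1 / maxNorm
A`; moreover `L` has unit diagonal. -/
theorem GENPDefined.inv_maxNorm_sq_le_rhoMax {m : ℕ} [NeZero m] {A : Matrix (Fin m) (Fin m) ℝ}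
    (h : GENPDefined A) (hA : A * A.transpose = 1) : (maxNorm A ^ 2)⁻¹ ≤ rhoMax A := by
  set z : Fin m := ⟨m - 1, Nat.sub_lt (NeZero.pos m) one_pos⟩ with hz
  have hzt : ∀ i : Fin m, i ≤ z := fun i => by rw [Fin.le_def]; simp only [hz]; omega
  have h1 : genpU A z z * A z z = 1 := h.isLU.last_pivot_mul_inv hA z hzt
  have h0 : A z z ≠ 0 := right_ne_zero_of_mul_eq_one h1
  have hle := abs_le_maxNorm A z z
  have hpos : 0 < maxNorm A := (abs_pos.2 h0).trans_le hle
  have hL : 1 ≤ maxNorm (genpL A) := by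
    simpa [genpL] using abs_le_maxNorm (genpL A) z z
  have hU : (maxNorm A)⁻¹ ≤ ⨆ k : Fin m, maxNorm (geIter A k) := by
    refine le_trans ?_ (maxNorm_geIter_le_iSup A z)
    refine le_trans ?_ (abs_le_maxNorm (genpU A) z z)
    rw [eq_inv_of_mul_eq_one_left h1, abs_inv]
    exact inv_anti₀ (abs_pos.2 h0) hle
  rw [rhoMax, le_div_iff₀ hpos]
  calc (maxNorm A ^ 2)⁻¹ * maxNorm A = 1 * (maxNorm A)⁻¹ := by field_simp
    _ ≤ _ := mul_le_mul hL hU (by positivity) (zero_le_one.trans hL)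

/-! ## Pivoting for matrices with a dominant factorization -/

section Pivoting

variable {m : ℕ}

theorem interchanges_succ (r : Fin m → Fin m) {k : ℕ} (h : k < m) :
    interchanges r (k + 1) = interchanges r k * Equiv.swap ⟨k, h⟩ (r ⟨k, h⟩) := by
  simp [interchanges, h]

theorem interchanges_congr {r r' : Fin m → Fin m} :
    ∀ k : ℕ, (∀ j : Fin m, (j : ℕ) < k → r j = r' j) → interchanges r k = interchanges r' k
  | 0, _ => rfl
  | k + 1, h => by
    have ih := interchanges_congr k fun j hj => h j (hj.trans k.lt_succ_self)
    by_cases hk : k < m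
    · rw [interchanges_succ r hk, interchanges_succ r' hk, ih, h ⟨k, hk⟩ k.lt_succ_self]
    · simp [interchanges, hk, ih]

theorem interchanges_self : ∀ k : ℕ, interchanges (fun i : Fin m => i) k = 1
  | 0 => rfl
  | k + 1 => by
    by_cases hk : k < m
    · rw [interchanges_succ _ hk, interchanges_self k, Equiv.swap_self]
      rfl
    · simp [interchanges, hk, interchanges_self k]

/-- Interchanging at each step `j < k` the current position of `σ j` into position `j` produces
a permutation that agrees with `σ` below `k`. -/
theorem interchanges_apply_of_lt {σ : Equiv.Perm (Fin m)} {r : Fin m → Fin m} :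
    ∀ k : ℕ, k ≤ m → (∀ j : Fin m, (j : ℕ) < k → r j = (interchanges r j)⁻¹ (σ j)) →
      ∀ i : Fin m, (i : ℕ) < k → interchanges r k i = σ i
  | k + 1, hk, h, i, hi => by
    have hk' : k < m := hk
    have ih := interchanges_apply_of_lt (σ := σ) k hk'.le
      fun j hj => h j (hj.trans k.lt_succ_self)
    have hr := h ⟨k, hk'⟩ k.lt_succ_self
    rw [interchanges_succ r hk', Equiv.Perm.mul_apply]
    rcases (Nat.lt_succ_iff.1 hi).lt_or_eq with h1 | h1
    · rw [Equiv.swap_apply_of_ne_of_ne, ih i h1]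
      · exact fun h2 => h1.ne (congrArg Fin.val h2)
      · intro h2
        rw [hr, Equiv.Perm.eq_inv_iff_eq, ih i h1, σ.injective.eq_iff] at h2
        exact h1.ne (congrArg Fin.val h2)
    · have : i = ⟨k, hk'⟩ := Fin.ext h1
      rw [this, Equiv.swap_apply_left, hr]
      exact Equiv.apply_symm_apply _ _

/-- The right-hand side at `k` involves only the values of `r` below `k`, so `r` can be built one
value at a time. -/
theorem exists_interchanges (σ : Equiv.Perm (Fin m)) :
    ∃ r : Fin m → Fin m, ∀ k : Fin m, r k = (interchanges r k)⁻¹ (σ k) := by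
  suffices h : ∀ K : ℕ, ∃ r : Fin m → Fin m,
      ∀ k : Fin m, (k : ℕ) < K → r k = (interchanges r k)⁻¹ (σ k) by
    obtain ⟨r, hr⟩ := h m
    exact ⟨r, fun k => hr k k.2⟩
  intro K
  induction K with
  | zero => exact ⟨id, by simp⟩
  | succ K ih =>
    obtain ⟨r, hr⟩ := ih
    by_cases hK : K < m
    · refine ⟨Function.update r ⟨K, hK⟩ ((interchanges r K)⁻¹ (σ ⟨K, hK⟩)), fun k hk => ?_⟩
      have hc : ∀ k : ℕ, k ≤ K → interchanges
          (Function.update r ⟨K, hK⟩ ((interchanges r K)⁻¹ (σ ⟨K, hK⟩))) k = interchanges r k :=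
        fun k hk => interchanges_congr k fun j hj =>
          Function.update_of_ne (fun h => by subst h; exact absurd hk (not_le.2 hj)) _ _
      rw [hc k (Nat.lt_succ_iff.1 hk)]
      rcases (Nat.lt_succ_iff.1 hk).lt_or_eq with h1 | h1
      · rw [Function.update_of_ne fun h => h1.ne (congrArg Fin.val h), hr k h1]
      · have : k = ⟨K, hK⟩ := Fin.ext h1
        subst this
        simp
    · exact ⟨r, fun k _ => hr k (k.2.trans_le (not_lt.1 hK))⟩

theorem workMat_succ (A : Matrix (Fin m) (Fin m) ℝ) (p : Fin m → Fin m × Fin m) {k : ℕ}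
    (h : k < m) :
    workMat A p (k + 1) = geStep ⟨k, h⟩ ((workMat A p k).submatrix
      (Equiv.swap ⟨k, h⟩ (p ⟨k, h⟩).1) (Equiv.swap ⟨k, h⟩ (p ⟨k, h⟩).2)) := by
  simp [workMat, h]

/-- Such a permutation leaves the pivot row in place and only reorders the rows below it, each of
which is eliminated independently. -/
theorem geStep_submatrix (A : Matrix (Fin m) (Fin m) ℝ) (k : Fin m) (π : Equiv.Perm (Fin m))
    (hπ : ∀ i ≤ k, π i = i) :
    geStep k (A.submatrix π id) = (geStep k A).submatrix π id := by
  have hlt : ∀ i, k < π i ↔ k < i := fun i => by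
    rw [← not_iff_not, not_lt, not_lt]
    constructor
    · intro h
      rwa [← π.injective (hπ _ h)]
    · intro h
      rwa [hπ i h]
  ext i j
  simp [geStep, hlt, hπ k le_rfl]

/-- If the leading column of the active submatrix has a unique entry of maximal modulus, and
this entry is maximal in its row, then both strategies choose it. -/
theorem PivotStrategy.admissible_iff (s : PivotStrategy) {W : Matrix (Fin m) (Fin m) ℝ}
    {k r : Fin m} (hkr : k ≤ r) (hcol : ∀ i, k ≤ i → i ≠ r → |W i k| < |W r k|)
    (hrow : ∀ j, k ≤ j → |W r j| ≤ |W r k|) (q : Fin m × Fin m) :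
    s.Admissible W k q ↔ q = (r, k) := by
  have hmax : IsColMax W k r k := ⟨hkr, le_rfl, fun i hi => by
    by_cases h : i = r
    · rw [h]
    · exact (hcol i hi h).le⟩
  have hrmax : IsRowMax W k r k := ⟨hkr, le_rfl, hrow⟩
  have huniq : ∀ i, IsColMax W k i k → i = r := fun i hi => by
    by_contra h
    exact absurd (hi.2.2 r hkr) (not_le.2 (hcol i hi.1 h))
  cases s with
  | partialPivoting =>
    constructor
    · rintro ⟨h1, h2⟩
      exact Prod.ext (huniq _ h2) h1
    · rintro rfl
      exact ⟨rfl, hmax⟩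
  | rookPivoting =>
    constructor
    · rintro ⟨h1, -, -⟩
      have key : ∀ i j, RookVisits W k i j → i = r ∧ j = k := fun i j h => by
        induction h with
        | start i hi => exact ⟨huniq i hi, rfl⟩
        | alongRow i j j' _ hn _ ih =>
          obtain ⟨rfl, rfl⟩ := ih
          exact absurd hrmax hn
        | alongCol i i' j _ hn _ ih =>
          obtain ⟨rfl, rfl⟩ := ih
          exact absurd hmax hn
      obtain ⟨h2, h3⟩ := key _ _ h1
      exact Prod.ext h2 h3
    · rintro rfl
      exact ⟨.start r hmax, hrmax, hmax⟩

/-- An `LU` factorization whose multipliers are less than one in modulus, and whose nonzero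
pivots are maximal in their rows of the upper triangular factor. -/
structure IsDominantLU (A L U : Matrix (Fin m) (Fin m) ℝ) : Prop extends IsLU A L U where
  multiplier_lt : ∀ i j, j < i → |L i j| < 1
  pivot_ne : ∀ k, U k k ≠ 0
  le_pivot : ∀ k j, |U k j| ≤ |U k k|

variable {A L U : Matrix (Fin m) (Fin m) ℝ} {σ : Equiv.Perm (Fin m)}

theorem inv_mul_interchanges_apply {r : Fin m → Fin m} {k : ℕ} (hk : k ≤ m)
    (h : ∀ j : Fin m, (j : ℕ) < k → r j = (interchanges r j)⁻¹ (σ j)) (i : Fin m)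
    (hi : (i : ℕ) < k) : (σ⁻¹ * interchanges r k) i = i := by
  rw [Equiv.Perm.mul_apply, interchanges_apply_of_lt k hk h i hi]
  exact Equiv.symm_apply_apply _ _

/-- Elimination with the interchanges prescribed by `σ` is elimination without pivoting on the
row-permuted matrix, except that the rows not yet used as pivot rows are still in a different order.
-/
theorem workMat_eq_submatrix (A : Matrix (Fin m) (Fin m) ℝ) {p : Fin m → Fin m × Fin m} :
    ∀ k : ℕ, k ≤ m → (∀ j : Fin m, (j : ℕ) < k →
      p j = ((interchanges (fun k => (p k).1) j)⁻¹ (σ j), j)) →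
      workMat A p k = (geIter (A.submatrix σ id) k).submatrix
        (σ⁻¹ * interchanges (fun k => (p k).1) k : Equiv.Perm (Fin m)) id
  | 0, _, _ => by
    ext i j
    simp [workMat, geIter, interchanges]
  | k + 1, hk, h => by
    have hk' : k < m := hk
    have ih := workMat_eq_submatrix A k hk'.le fun j hj => h j (hj.trans k.lt_succ_self)
    have hp := h ⟨k, hk'⟩ k.lt_succ_self
    have hfix := inv_mul_interchanges_apply (r := fun k => (p k).1) hk
      fun j hj => congrArg Prod.fst (h j hj)
    have h2 : (p ⟨k, hk'⟩).2 = ⟨k, hk'⟩ := congrArg Prod.snd hp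
    rw [workMat_succ A p hk', ih, h2, Equiv.swap_self]
    have hg : geIter (A.submatrix σ id) (k + 1)
        = geStep ⟨k, hk'⟩ (geIter (A.submatrix σ id) k) := by simp [geIter, hk']
    rw [hg, ← geStep_submatrix _ _ _ fun i hi => hfix i (Nat.lt_succ_of_le hi),
      interchanges_succ _ hk']
    congr 1

/-- Up to row order the active column consists of the numbers `L i k * U k k`. The row waiting to
become row `k` contributes `U k k`, every other one something strictly smaller in modulus. That row
is row `k` of `U`, where the pivot is maximal, so a rook search stops at once. -/
theorem IsDominantLU.admissible_workMat_iff (h : IsDominantLU (A.submatrix σ id) L U)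
    (s : PivotStrategy) {p : Fin m → Fin m × Fin m} (k : Fin m)
    (hp : ∀ j : Fin m, j < k → p j = ((interchanges (fun k => (p k).1) j)⁻¹ (σ j), j))
    (q : Fin m × Fin m) :
    s.Admissible (workMat A p k) k q ↔
      q = ((interchanges (fun k => (p k).1) k)⁻¹ (σ k), k) := by
  have hU : PivotsNeZero U := fun k _ => h.pivot_ne k
  have hfix := inv_mul_interchanges_apply (r := fun k => (p k).1) k.2.le
    fun j hj => congrArg Prod.fst (hp j hj)
  set ι := interchanges (fun k => (p k).1) k with hι
  -- A permutation fixing every index below `k` maps the remaining indices among themselves.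
  have hge : ∀ i, k ≤ i → k ≤ (σ⁻¹ * ι) i := fun i hi => by
    by_contra hlt
    rw [not_le] at hlt
    have := (σ⁻¹ * ι).injective (hfix _ hlt)
    rw [this] at hlt
    exact absurd hi (not_le.2 hlt)
  have hr : (σ⁻¹ * ι) (ι⁻¹ (σ k)) = k := by simp
  have hW := workMat_eq_submatrix (σ := σ) A k k.2.le hp
  have hkr : k ≤ ι⁻¹ (σ k) := by
    by_contra hlt
    rw [not_le] at hlt
    have := hfix _ hlt
    rw [hr] at this
    exact hlt.ne this.symm
  have hWr : ∀ j, workMat A p k (ι⁻¹ (σ k)) j = U k j := fun j => by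
    rw [hW, Matrix.submatrix_apply, hr]
    exact h.geIter_row hU k j
  refine s.admissible_iff hkr (fun i hi hne => ?_) (fun j _ => ?_) q
  · have hne' : (σ⁻¹ * ι) i ≠ k := fun h' => hne ((σ⁻¹ * ι).injective (h'.trans hr.symm))
    rw [hWr, hW, Matrix.submatrix_apply, id, h.geIter_col hU _ _ (hge i hi), abs_mul]
    exact mul_lt_of_lt_one_left (abs_pos.2 (h.pivot_ne k))
      (h.multiplier_lt _ _ (lt_of_le_of_ne (hge i hi) hne'.symm))
  · rw [hWr, hWr]
    exact h.le_pivot k j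

theorem IsDominantLU.isRun_iff (h : IsDominantLU (A.submatrix σ id) L U) (s : PivotStrategy)
    {p : Fin m → Fin m × Fin m} :
    s.IsRun A p ↔ ∀ k, p k = ((interchanges (fun k => (p k).1) k)⁻¹ (σ k), k) := by
  constructor
  · intro hp k
    induction k using WellFoundedLT.induction with
    | ind k ih => exact (h.admissible_workMat_iff s k ih _).1 (hp k)
  · exact fun hp k => (h.admissible_workMat_iff s k (fun j _ => hp j) _).2 (hp k)

theorem IsDominantLU.exists_isRun (h : IsDominantLU (A.submatrix σ id) L U) (s : PivotStrategy) :
    ∃ p, s.IsRun A p := by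
  obtain ⟨r, hr⟩ := exists_interchanges σ
  exact ⟨fun k => (r k, k), (h.isRun_iff s).2 fun k => by rw [← hr k]⟩

theorem IsDominantLU.rowPermMatrix_eq (h : IsDominantLU (A.submatrix σ id) L U)
    {s : PivotStrategy} {p : Fin m → Fin m × Fin m} (hp : s.IsRun A p) :
    rowPermMatrix p = σ.permMatrix ℝ := by
  have := (h.isRun_iff s).1 hp
  rw [rowPermMatrix]
  congr 1
  ext i : 1
  exact interchanges_apply_of_lt m le_rfl (fun j _ => congrArg Prod.fst (this j)) i i.2

theorem IsDominantLU.colPermMatrix_eq (h : IsDominantLU (A.submatrix σ id) L U)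
    {s : PivotStrategy} {p : Fin m → Fin m × Fin m} (hp : s.IsRun A p) :
    colPermMatrix p = 1 := by
  have h2 : (fun k => (p k).2) = fun k => k :=
    funext fun k => congrArg Prod.snd ((h.isRun_iff s).1 hp k)
  rw [colPermMatrix, h2, interchanges_self, inv_one, Matrix.permMatrix_one]

theorem permMatrix_mul_eq_submatrix (A : Matrix (Fin m) (Fin m) ℝ) (σ : Equiv.Perm (Fin m)) :
    σ.permMatrix ℝ * A = A.submatrix σ id := by
  have := permMatrix_mul_mul_permMatrix_apply A σ 1
  rwa [Matrix.permMatrix_one, Matrix.mul_one] at this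

theorem IsDominantLU.pivoted_eq (h : IsDominantLU (A.submatrix σ id) L U)
    {s : PivotStrategy} {p : Fin m → Fin m × Fin m} (hp : s.IsRun A p) :
    pivoted A p = A.submatrix σ id := by
  rw [pivoted, h.rowPermMatrix_eq hp, h.colPermMatrix_eq hp, Matrix.mul_one,
    permMatrix_mul_eq_submatrix]

theorem IsDominantLU.factors_iff (h : IsDominantLU (A.submatrix σ id) L U) (s : PivotStrategy)
    (P' Q' L' U' : Matrix (Fin m) (Fin m) ℝ) :
    s.Factors A P' Q' L' U' ↔ P' = σ.permMatrix ℝ ∧ Q' = 1 ∧ L' = L ∧ U' = U := by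
  have hU : PivotsNeZero U := fun k _ => h.pivot_ne k
  constructor
  · rintro ⟨p, hp, rfl, rfl, rfl, rfl⟩
    rw [h.pivoted_eq hp]
    exact ⟨h.rowPermMatrix_eq hp, h.colPermMatrix_eq hp, h.genpL_eq hU, h.genpU_eq hU⟩
  · rintro ⟨rfl, rfl, rfl, rfl⟩
    obtain ⟨p, hp⟩ := h.exists_isRun s
    refine ⟨p, hp, (h.rowPermMatrix_eq hp).symm, (h.colPermMatrix_eq hp).symm, ?_, ?_⟩
    · rw [h.pivoted_eq hp, h.genpL_eq hU]
    · rw [h.pivoted_eq hp, h.genpU_eq hU]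

end Pivoting

/-! ## Iterated Kronecker products of `2 × 2` matrices -/

/-- The index of the entry `i` of the block `x`. -/
def blockIndex (n : ℕ) : Fin 2 × Fin (2 ^ n) ≃ Fin (2 ^ (n + 1)) :=
  finProdFinEquiv.trans (finCongr (pow_succ' 2 n).symm)

theorem blockIndex_val (n : ℕ) (x : Fin 2) (i : Fin (2 ^ n)) :
    (blockIndex n (x, i) : ℕ) = i + 2 ^ n * x := rfl

theorem blockIndex_lt_iff {n : ℕ} {x y : Fin 2} {i j : Fin (2 ^ n)} :
    blockIndex n (x, i) < blockIndex n (y, j) ↔ x < y ∨ x = y ∧ i < j := by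
  have hi := i.2
  have hj := j.2
  rw [Fin.lt_def, blockIndex_val, blockIndex_val]
  fin_cases x <;> fin_cases y <;> simp <;> omega

theorem forall_blockIndex {n : ℕ} {p : Fin (2 ^ (n + 1)) → Prop} :
    (∀ i, p i) ↔ ∀ x i, p (blockIndex n (x, i)) := by
  rw [(blockIndex n).forall_congr_right.symm, Prod.forall]

theorem sum_blockIndex {n : ℕ} (f : Fin (2 ^ (n + 1)) → ℝ) :
    ∑ l, f l = ∑ l, f (blockIndex n (0, l)) + ∑ l, f (blockIndex n (1, l)) := by
  rw [← (blockIndex n).sum_comp, Fintype.sum_prod_type, Fin.sum_univ_two]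

/-- The Kronecker product `F (n - 1) ⊗ ⋯ ⊗ F 0`. -/
noncomputable def kron : (n : ℕ) → (Fin n → Matrix (Fin 2) (Fin 2) ℝ) →
    Matrix (Fin (2 ^ n)) (Fin (2 ^ n)) ℝ
  | 0, _ => 1
  | n + 1, F => Matrix.of fun i j =>
    F (Fin.last n) ((blockIndex n).symm i).1 ((blockIndex n).symm j).1 *
      kron n (fun k => F k.castSucc) ((blockIndex n).symm i).2 ((blockIndex n).symm j).2

theorem kron_blockIndex {n : ℕ} (F : Fin (n + 1) → Matrix (Fin 2) (Fin 2) ℝ) (x y : Fin 2)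
    (i j : Fin (2 ^ n)) :
    kron (n + 1) F (blockIndex n (x, i)) (blockIndex n (y, j)) =
      F (Fin.last n) x y * kron n (fun k => F k.castSucc) i j := by
  simp [kron]

theorem ext_blockIndex {n : ℕ} {A A' : Matrix (Fin (2 ^ (n + 1))) (Fin (2 ^ (n + 1))) ℝ}
    (h : ∀ x i y j, A (blockIndex n (x, i)) (blockIndex n (y, j))
      = A' (blockIndex n (x, i)) (blockIndex n (y, j))) : A = A' := by
  ext i j
  revert i j
  simp only [forall_blockIndex]
  exact h

theorem kron_zero_apply (F : Fin 0 → Matrix (Fin 2) (Fin 2) ℝ) (i j : Fin (2 ^ 0)) :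
    kron 0 F i j = 1 := by
  have : i = j := Fin.ext (by have := i.2; have := j.2; simp at *)
  rw [this]
  exact Matrix.one_apply_eq j

theorem kron_mul : ∀ (n : ℕ) (F G : Fin n → Matrix (Fin 2) (Fin 2) ℝ),
    kron n F * kron n G = kron n (fun k => F k * G k)
  | 0, _, _ => Matrix.one_mul 1
  | n + 1, F, G => by
    refine ext_blockIndex fun x i y j => ?_
    rw [Matrix.mul_apply, sum_blockIndex]
    simp only [kron_blockIndex]
    rw [← kron_mul n, Matrix.mul_apply, Matrix.mul_apply, Fin.sum_univ_two, add_mul,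
      Finset.mul_sum, Finset.mul_sum]
    congr 1 <;> exact Finset.sum_congr rfl fun l _ => by ring

theorem kron_one : ∀ n : ℕ, kron n (fun _ => 1) = 1
  | 0 => rfl
  | n + 1 => by
    refine ext_blockIndex fun x i y j => ?_
    rw [kron_blockIndex, kron_one n]
    simp only [Matrix.one_apply, (blockIndex n).injective.eq_iff, Prod.mk.injEq]
    split_ifs <;> simp_all

theorem kron_transpose : ∀ (n : ℕ) (F : Fin n → Matrix (Fin 2) (Fin 2) ℝ),
    (kron n F).transpose = kron n (fun k => (F k).transpose)
  | 0, _ => Matrix.transpose_one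
  | n + 1, F => by
    refine ext_blockIndex fun x i y j => ?_
    rw [Matrix.transpose_apply, kron_blockIndex, kron_blockIndex, ← kron_transpose n]
    rfl

theorem kron_map_abs : ∀ (n : ℕ) (F : Fin n → Matrix (Fin 2) (Fin 2) ℝ),
    (kron n F).map (fun x => |x|) = kron n (fun k => (F k).map (fun x => |x|))
  | 0, F => by
    ext i j
    rw [Matrix.map_apply, kron_zero_apply, kron_zero_apply, abs_one]
  | n + 1, F => by
    refine ext_blockIndex fun x i y j => ?_
    rw [Matrix.map_apply, kron_blockIndex, kron_blockIndex, ← kron_map_abs n, abs_mul]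
    rfl

instance neZeroTwoPow (n : ℕ) : NeZero (2 ^ n) := ⟨by positivity⟩

theorem maxNorm_kron : ∀ (n : ℕ) (F : Fin n → Matrix (Fin 2) (Fin 2) ℝ),
    maxNorm (kron n F) = ∏ k, maxNorm (F k)
  | 0, F => by
    rw [Fin.prod_univ_zero]
    exact maxNorm_eq (fun i j => by rw [kron_zero_apply, abs_one]) 0 0
      (by rw [kron_zero_apply, abs_one])
  | n + 1, F => by
    rw [Fin.prod_univ_castSucc, ← maxNorm_kron n, mul_comm]
    obtain ⟨x, y, hxy⟩ := exists_abs_eq_maxNorm (F (Fin.last n))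
    obtain ⟨i, j, hij⟩ := exists_abs_eq_maxNorm (kron n fun k => F k.castSucc)
    refine maxNorm_eq ?_ (blockIndex n (x, i)) (blockIndex n (y, j)) ?_
    · simp only [forall_blockIndex, kron_blockIndex, abs_mul]
      exact fun x i y j => mul_le_mul (abs_le_maxNorm _ _ _) (abs_le_maxNorm _ _ _)
        (abs_nonneg _) ((abs_nonneg _).trans_eq hxy)
    · rw [kron_blockIndex, abs_mul, hxy, hij]

theorem linfNorm_kron : ∀ (n : ℕ) (F : Fin n → Matrix (Fin 2) (Fin 2) ℝ),
    linfNorm (kron n F) = ∏ k, linfNorm (F k)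
  | 0, F => by
    rw [Fin.prod_univ_zero]
    have h : ∀ i, ∑ j, |kron 0 F i j| = 1 := fun i => by
      simp only [kron_zero_apply, abs_one]
      simp
    exact linfNorm_eq (fun i => (h i).le) 0 (h 0)
  | n + 1, F => by
    rw [Fin.prod_univ_castSucc, ← linfNorm_kron n, mul_comm]
    have hrow : ∀ x i, ∑ j, |kron (n + 1) F (blockIndex n (x, i)) j|
        = (∑ y, |F (Fin.last n) x y|) * ∑ j, |kron n (fun k => F k.castSucc) i j| := by
      intro x i
      rw [sum_blockIndex]
      simp only [kron_blockIndex, abs_mul, Fin.sum_univ_two, add_mul, Finset.mul_sum,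
        Finset.sum_add_distrib]
    obtain ⟨x, hx⟩ := exists_rowSum_eq_linfNorm (F (Fin.last n))
    obtain ⟨i, hi⟩ := exists_rowSum_eq_linfNorm (kron n fun k => F k.castSucc)
    refine linfNorm_eq ?_ (blockIndex n (x, i)) (by rw [hrow, hx, hi])
    simp only [forall_blockIndex, hrow]
    exact fun x' i' => mul_le_mul (rowSum_le_linfNorm _ _) (rowSum_le_linfNorm _ _)
      (Finset.sum_nonneg fun _ _ => abs_nonneg _)
      (hx ▸ Finset.sum_nonneg fun _ _ => abs_nonneg _)

/-- The index order is lexicographic with the outer factor first: if `i < j`, then either the outer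
entry lies above the diagonal or the inner one does. -/
theorem kron_lower : ∀ (n : ℕ) {F : Fin n → Matrix (Fin 2) (Fin 2) ℝ}, (∀ k, F k 0 1 = 0) →
    ∀ i j, i < j → kron n F i j = 0
  | 0, _, _, i, j, h => by
    have := i.2
    have := j.2
    rw [Fin.lt_def] at h
    simp at *
  | n + 1, F, hF, i, j, h => by
    revert i j
    simp only [forall_blockIndex, blockIndex_lt_iff, kron_blockIndex]
    rintro x i y j (h | ⟨-, h⟩)
    · have : x = 0 ∧ y = 1 := by omega
      rw [this.1, this.2, hF, zero_mul]
    · rw [kron_lower n (fun k => hF k.castSucc) i j h, mul_zero]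

theorem kron_upper (n : ℕ) {F : Fin n → Matrix (Fin 2) (Fin 2) ℝ} (hF : ∀ k, F k 1 0 = 0)
    (i j : Fin (2 ^ n)) (h : j < i) : kron n F i j = 0 := by
  have := kron_lower n (F := fun k => (F k).transpose) hF j i h
  rwa [← kron_transpose, Matrix.transpose_apply] at this

theorem kron_diag_one : ∀ (n : ℕ) {F : Fin n → Matrix (Fin 2) (Fin 2) ℝ},
    (∀ k x, F k x x = 1) → ∀ i, kron n F i i = 1
  | 0, _, _, i => kron_zero_apply _ i i
  | n + 1, F, hF, i => by
    revert i
    simp only [forall_blockIndex, kron_blockIndex]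
    intro x i
    rw [hF, kron_diag_one n (fun k => hF k.castSucc), one_mul]

theorem kron_diag_ne_zero : ∀ (n : ℕ) {F : Fin n → Matrix (Fin 2) (Fin 2) ℝ},
    (∀ k x, F k x x ≠ 0) → ∀ i, kron n F i i ≠ 0
  | 0, _, _, i => by rw [kron_zero_apply]; exact one_ne_zero
  | n + 1, F, hF, i => by
    revert i
    simp only [forall_blockIndex, kron_blockIndex]
    exact fun x i => mul_ne_zero (hF _ _) (kron_diag_ne_zero n (fun k => hF k.castSucc) i)

theorem kron_le_diag : ∀ (n : ℕ) {F : Fin n → Matrix (Fin 2) (Fin 2) ℝ},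
    (∀ k x y, |F k x y| ≤ |F k x x|) → ∀ i j, |kron n F i j| ≤ |kron n F i i|
  | 0, _, _, i, j => by rw [kron_zero_apply, kron_zero_apply]
  | n + 1, F, hF, i, j => by
    revert i j
    simp only [forall_blockIndex, kron_blockIndex, abs_mul]
    exact fun x i y j => mul_le_mul (hF _ _ _) (kron_le_diag n (fun k => hF k.castSucc) i j)
      (abs_nonneg _) (abs_nonneg _)

/-- An off-diagonal entry involves at least one off-diagonal entry of a factor, which is below one
in modulus; no other factor entry exceeds one. -/
theorem kron_off_diag_lt_one : ∀ (n : ℕ) {F : Fin n → Matrix (Fin 2) (Fin 2) ℝ},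
    (∀ k x, F k x x = 1) → (∀ k x y, x ≠ y → |F k x y| < 1) → ∀ i j, i ≠ j → |kron n F i j| < 1
  | 0, _, _, _, i, j, h => by
    refine absurd (Fin.ext ?_) h
    have := i.2
    have := j.2
    simp at *
  | n + 1, F, h1, hF, i, j, h => by
    revert i j
    simp only [forall_blockIndex, kron_blockIndex, abs_mul, ne_eq,
      (blockIndex n).injective.eq_iff, Prod.mk.injEq, not_and]
    intro x i y j h
    have ih := kron_off_diag_lt_one n (fun k => h1 k.castSucc) fun k => hF k.castSucc
    have hle : |kron n (fun k => F k.castSucc) i j| ≤ 1 := by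
      by_cases hij : i = j
      · rw [hij, kron_diag_one n fun k => h1 k.castSucc, abs_one]
      · exact (ih i j hij).le
    by_cases hxy : x = y
    · rw [hxy, h1, abs_one, one_mul]
      exact ih i j (h hxy)
    · exact mul_lt_one_of_nonneg_of_lt_one_left (abs_nonneg _) (hF _ x y hxy) hle

/-- The permutation of the indices of a Kronecker product that acts by `δ k` in the factor `k`. -/
def kronPerm : (n : ℕ) → (Fin n → Equiv.Perm (Fin 2)) → Equiv.Perm (Fin (2 ^ n))
  | 0, _ => 1
  | n + 1, δ => (blockIndex n).permCongr
    ((δ (Fin.last n)).prodCongr (kronPerm n fun k => δ k.castSucc))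

theorem kron_submatrix_kronPerm : ∀ (n : ℕ) (F : Fin n → Matrix (Fin 2) (Fin 2) ℝ)
    (δ : Fin n → Equiv.Perm (Fin 2)),
    (kron n F).submatrix (kronPerm n δ) id = kron n (fun k => (F k).submatrix (δ k) id)
  | 0, F, δ => by
    ext i j
    rw [Matrix.submatrix_apply, kron_zero_apply, kron_zero_apply]
  | n + 1, F, δ => by
    refine ext_blockIndex fun x i y j => ?_
    have : kronPerm (n + 1) δ (blockIndex n (x, i))
        = blockIndex n (δ (Fin.last n) x, kronPerm n (fun k => δ k.castSucc) i) := by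
      simp [kronPerm, Equiv.permCongr_apply]
    rw [Matrix.submatrix_apply, this, id, kron_blockIndex, kron_blockIndex,
      ← kron_submatrix_kronPerm n]
    rfl

/-! ## Butterfly matrices as Kronecker products -/

/-- The orthogonal matrix with first row `(a, b)` and determinant `ε`. -/
noncomputable def rot (a b ε : ℝ) : Matrix (Fin 2) (Fin 2) ℝ := !![a, b; -ε * b, ε * a]

/-- The lower triangular factor of `rot a b ε`. -/
noncomputable def rotL (a b ε : ℝ) : Matrix (Fin 2) (Fin 2) ℝ := !![1, 0; -ε * b / a, 1]

/-- The upper triangular factor of `rot a b ε`. -/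
noncomputable def rotU (a b ε : ℝ) : Matrix (Fin 2) (Fin 2) ℝ := !![a, b; 0, ε / a]

theorem butterfly_eq_kron : ∀ (n : ℕ) (θ : Fin n → ℝ),
    butterfly n θ = kron n (fun k => rot (Real.cos (θ k)) (Real.sin (θ k)) 1)
  | 0, _ => rfl
  | n + 1, θ => by
    refine ext_blockIndex fun x i y j => ?_
    have hs : ∀ x i, finSumFinEquiv.symm
        ((finCongr (two_pow_add_two_pow n)).symm (blockIndex n (x, i)))
          = if x = 0 then Sum.inl i else Sum.inr i := by
      intro x i
      rw [Equiv.symm_apply_eq]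
      fin_cases x <;> exact Fin.ext (by simp [blockIndex_val])
    rw [kron_blockIndex, ← butterfly_eq_kron n fun k => θ k.castSucc]
    simp only [butterfly, butterflyStep, Matrix.reindex_apply, Matrix.submatrix_apply,
      Matrix.fromBlocks_multiply, hs]
    fin_cases x <;> fin_cases y <;> simp [rot]

/-- By `a ^ 2 + b ^ 2 = 1` the Schur complement `ε * a + ε * b ^ 2 / a` equals `ε / a`. -/
theorem rot_eq_mul {a b : ℝ} (ε : ℝ) (ha : a ≠ 0) (hab : a ^ 2 + b ^ 2 = 1) :
    rot a b ε = rotL a b ε * rotU a b ε := by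
  have h : -ε * b / a * b + ε / a = ε * a := by
    field_simp
    linear_combination ε * (-hab)
  have h' : -ε * b / a * a = -ε * b := by field_simp
  ext x y
  fin_cases x <;> fin_cases y <;>
    simp [rot, rotL, rotU, Matrix.mul_apply, Fin.sum_univ_two, -neg_mul, h, h']

/-! ### Norms of 2 × 2 matrices -/

theorem maxNorm_fin_two (A : Matrix (Fin 2) (Fin 2) ℝ) :
    maxNorm A = max (max |A 0 0| |A 0 1|) (max |A 1 0| |A 1 1|) := by
  refine le_antisymm (maxNorm_le (by positivity) fun i j => ?_)
    (max_le (max_le ?_ ?_) (max_le ?_ ?_)) <;> try exact abs_le_maxNorm _ _ _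
  fin_cases i <;> fin_cases j <;> simp

theorem linfNorm_fin_two (A : Matrix (Fin 2) (Fin 2) ℝ) :
    linfNorm A = max (|A 0 0| + |A 0 1|) (|A 1 0| + |A 1 1|) := by
  have h : ∀ i, ∑ j, |A i j| = |A i 0| + |A i 1| := fun i => Fin.sum_univ_two _
  rcases le_total (|A 0 0| + |A 0 1|) (|A 1 0| + |A 1 1|) with h' | h'
  · rw [max_eq_right h']
    exact linfNorm_eq (fun i => by fin_cases i <;> simp [h, h']) 1 (h 1)
  · rw [max_eq_left h']
    exact linfNorm_eq (fun i => by fin_cases i <;> simp [h, h']) 0 (h 0)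

/-! ## Growth factors of Kronecker products of orthogonal matrices -/

theorem abs_le_one_of_sq_add_sq {a b : ℝ} (h : a ^ 2 + b ^ 2 = 1) : |a| ≤ 1 ∧ |b| ≤ 1 :=
  ⟨(sq_le_one_iff_abs_le_one a).1 (by nlinarith [sq_nonneg b]),
    (sq_le_one_iff_abs_le_one b).1 (by nlinarith [sq_nonneg a])⟩

theorem abs_convex_comb_le {a b x y M : ℝ} (h : a ^ 2 + b ^ 2 = 1) (hx : |x| ≤ M) (hy : |y| ≤ M) :
    |a ^ 2 * x + b ^ 2 * y| ≤ M := by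
  rw [abs_le] at *
  constructor <;> nlinarith [sq_nonneg a, sq_nonneg b]

theorem abs_mul_le_inv_mul {a c x M : ℝ} (hc : |c| ≤ |a|⁻¹) (hx : |x| ≤ M) :
    |c * x| ≤ M * |a|⁻¹ := by
  rw [abs_mul, mul_comm]
  exact mul_le_mul hx hc (abs_nonneg _) ((abs_nonneg _).trans hx)

section RotEntries

variable {a b ε : ℝ}

theorem abs_rotL_mul_rotU_zero_le (ha : a ≠ 0) (hab : a ^ 2 + b ^ 2 = 1) (hε : |ε| = 1)
    (x y : Fin 2) : |rotL a b ε x 0 * rotU a b ε 0 y| ≤ |a|⁻¹ := by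
  obtain ⟨h1, h2⟩ := abs_le_one_of_sq_add_sq hab
  have ha' := abs_pos.2 ha
  have h3 : 1 ≤ |a|⁻¹ := (one_le_inv₀ ha').2 h1
  have h4 : |b| / |a| * |a| = |b| := by field_simp
  have h5 : |b| / |a| * |b| ≤ |a|⁻¹ := by
    rw [div_mul_eq_mul_div, div_eq_mul_inv]
    exact mul_le_of_le_one_left (by positivity) (mul_le_one₀ h2 (abs_nonneg _) h2)
  fin_cases x <;> fin_cases y <;> simp [rotL, rotU, abs_mul, abs_div, hε, h4, h5] <;> linarith

theorem abs_rotL_mul_rotU_one_le (hε : |ε| = 1) (x y : Fin 2) :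
    |rotL a b ε x 1 * rotU a b ε 1 y| ≤ |a|⁻¹ := by
  fin_cases x <;> fin_cases y <;> simp [rotL, rotU, abs_div, hε]

theorem rotL_mul_rotU_one_eq_zero {x y : Fin 2} (h : ¬ (x = 1 ∧ y = 1)) :
    rotL a b ε x 1 * rotU a b ε 1 y = 0 := by
  fin_cases x <;> fin_cases y <;> simp [rotL, rotU] at h ⊢

theorem maxNorm_rot (hε : |ε| = 1) : maxNorm (rot a b ε) = max |a| |b| := by
  rw [maxNorm_fin_two]
  simp [rot, abs_mul, hε, max_comm |b|]

theorem maxNorm_rotL (hε : |ε| = 1) : maxNorm (rotL a b ε) = max 1 |b / a| := by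
  rw [maxNorm_fin_two]
  simp only [rotL, Matrix.of_apply, Matrix.cons_val', Matrix.cons_val_zero, Matrix.cons_val_one,
    Matrix.cons_val_fin_one, abs_one, abs_zero, abs_div, abs_mul, abs_neg, hε, one_mul,
    max_eq_left zero_le_one, max_comm _ (1 : ℝ)]
  rw [← max_assoc, max_self]

theorem maxNorm_rotU (ha : a ≠ 0) (hab : a ^ 2 + b ^ 2 = 1) (hε : |ε| = 1) :
    maxNorm (rotU a b ε) = |a|⁻¹ := by
  obtain ⟨h1, h2⟩ := abs_le_one_of_sq_add_sq hab
  have h3 : 1 ≤ |a|⁻¹ := (one_le_inv₀ (abs_pos.2 ha)).2 h1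
  rw [maxNorm_fin_two]
  simp only [rotU, Matrix.of_apply, Matrix.cons_val', Matrix.cons_val_zero, Matrix.cons_val_one,
    Matrix.cons_val_fin_one, abs_zero, abs_div, hε, one_div]
  rw [max_eq_right (by positivity : (0 : ℝ) ≤ |a|⁻¹), max_eq_right (max_le (h1.trans h3) (h2.trans h3))]

theorem linfNorm_rot (hε : |ε| = 1) : linfNorm (rot a b ε) = |a| + |b| := by
  rw [linfNorm_fin_two]
  simp [rot, abs_mul, hε, add_comm |b|]

theorem linfNorm_rotL (hε : |ε| = 1) : linfNorm (rotL a b ε) = 1 + |b / a| := by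
  rw [linfNorm_fin_two]
  simp only [rotL, Matrix.of_apply, Matrix.cons_val', Matrix.cons_val_zero, Matrix.cons_val_one,
    Matrix.cons_val_fin_one, abs_one, abs_zero, abs_div, abs_mul, abs_neg, hε, one_mul]
  rw [add_zero, add_comm, max_eq_right (le_add_of_nonneg_right (by positivity))]

theorem linfNorm_rotU (hε : |ε| = 1) : linfNorm (rotU a b ε) = max (|a| + |b|) |a|⁻¹ := by
  rw [linfNorm_fin_two]
  simp [rotU, abs_div, hε]

theorem linfNorm_abs_rotL_mul_abs_rotU (ha : a ≠ 0) (hab : a ^ 2 + b ^ 2 = 1) (hε : |ε| = 1) :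
    linfNorm ((rotL a b ε).map (fun x => |x|) * (rotU a b ε).map (fun x => |x|))
      = |b| + (|b| ^ 2 / |a| + |a|⁻¹) := by
  obtain ⟨h1, -⟩ := abs_le_one_of_sq_add_sq hab
  have ha' := abs_pos.2 ha
  have h3 : 1 ≤ |a|⁻¹ := (one_le_inv₀ ha').2 h1
  have h4 : |b| / |a| * |a| = |b| := by field_simp
  have h5 : |b| / |a| * |b| = |b| ^ 2 / |a| := by ring
  -- The second row sum dominates the first, since `|a| ≤ 1 ≤ |a|⁻¹`.
  have h6 : |a| + |b| ≤ |b| + (|b| ^ 2 / |a| + |a|⁻¹) := by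
    have : 0 ≤ |b| ^ 2 / |a| := by positivity
    linarith
  rw [linfNorm_fin_two]
  have hp : 0 ≤ |b| ^ 2 / |a| + |a|⁻¹ := by positivity
  simp only [rotL, rotU, Matrix.mul_apply, Fin.sum_univ_two, Matrix.map_apply, Matrix.of_apply,
    Matrix.cons_val', Matrix.cons_val_zero, Matrix.cons_val_one, Matrix.cons_val_fin_one,
    abs_one, abs_zero, abs_div, abs_mul, abs_neg, hε, one_mul, zero_mul, mul_zero, add_zero,
    abs_abs, h4, h5, one_div, abs_of_nonneg hp]
  exact max_eq_right h6

end RotEntries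

section KronRot

variable {n : ℕ} {a b ε : Fin n → ℝ}

theorem isLU_kron_rot (ha : ∀ k, a k ≠ 0) (hab : ∀ k, a k ^ 2 + b k ^ 2 = 1) :
    IsLU (kron n fun k => rot (a k) (b k) (ε k)) (kron n fun k => rotL (a k) (b k) (ε k))
      (kron n fun k => rotU (a k) (b k) (ε k)) where
  diag_one := kron_diag_one n fun k x => by fin_cases x <;> simp [rotL]
  lower := kron_lower n fun k => by simp [rotL]
  upper := kron_upper n fun k => by simp [rotU]
  eq_mul := by
    rw [kron_mul]
    congr 1
    ext1 k
    exact rot_eq_mul _ (ha k) (hab k)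

theorem kron_rotU_diag_ne_zero (ha : ∀ k, a k ≠ 0) (hε : ∀ k, |ε k| = 1) (i : Fin (2 ^ n)) :
    kron n (fun k => rotU (a k) (b k) (ε k)) i i ≠ 0 := by
  refine kron_diag_ne_zero n (fun k x => ?_) i
  have : ε k ≠ 0 := fun h => by simpa [h] using hε k
  fin_cases x <;> simp [rotU, ha k, this]

theorem isDominantLU_kron_rot (ha : ∀ k, a k ≠ 0) (hab : ∀ k, a k ^ 2 + b k ^ 2 = 1)
    (hε : ∀ k, |ε k| = 1) (hlt : ∀ k, |b k| < |a k|) :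
    IsDominantLU (kron n fun k => rot (a k) (b k) (ε k))
      (kron n fun k => rotL (a k) (b k) (ε k)) (kron n fun k => rotU (a k) (b k) (ε k)) where
  toIsLU := isLU_kron_rot ha hab
  multiplier_lt i j h := by
    refine kron_off_diag_lt_one n (fun k x => by fin_cases x <;> simp [rotL])
      (fun k x y hxy => ?_) i j h.ne'
    have : |b k| / |a k| < 1 := (div_lt_one (abs_pos.2 (ha k))).2 (hlt k)
    fin_cases x <;> fin_cases y <;> simp [rotL, abs_div, abs_mul, hε, this] at hxy ⊢
  pivot_ne := kron_rotU_diag_ne_zero ha hε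
  le_pivot := by
    refine kron_le_diag n fun k x y => ?_
    fin_cases x <;> fin_cases y <;> simp [rotU, (hlt k).le]

theorem kron_rot_mul_transpose (hab : ∀ k, a k ^ 2 + b k ^ 2 = 1) (hε : ∀ k, |ε k| = 1) :
    kron n (fun k => rot (a k) (b k) (ε k)) * (kron n fun k => rot (a k) (b k) (ε k)).transpose
      = 1 := by
  rw [kron_transpose, kron_mul, ← kron_one]
  congr 1
  ext1 k
  have h2 : ε k ^ 2 = 1 := by rw [← sq_abs, hε, one_pow]
  have h1 := hab k
  ext x y
  fin_cases x <;> fin_cases y <;> simp [rot, Matrix.mul_apply, Fin.sum_univ_two]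
  · linear_combination h1
  · ring
  · ring
  · linear_combination (a k ^ 2 + b k ^ 2) * h2 + h1

/-- Partial sums of the outer products that make up `L * U`, and their remainders, are bounded
by the last pivot. -/
theorem abs_partial_sum_kron_rot_le : ∀ (n : ℕ) {a b ε : Fin n → ℝ}, (∀ k, a k ≠ 0) →
    (∀ k, a k ^ 2 + b k ^ 2 = 1) → (∀ k, |ε k| = 1) → ∀ (K : ℕ) (i j : Fin (2 ^ n)),
      |∑ l : Fin (2 ^ n), if l.val < K then kron n (fun k => rotL (a k) (b k) (ε k)) i l *
        kron n (fun k => rotU (a k) (b k) (ε k)) l j else 0| ≤ ∏ k, |a k|⁻¹ ∧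
      |∑ l : Fin (2 ^ n), if K ≤ l.val then kron n (fun k => rotL (a k) (b k) (ε k)) i l *
        kron n (fun k => rotU (a k) (b k) (ε k)) l j else 0| ≤ ∏ k, |a k|⁻¹
  | 0, a, b, ε, _, _, _, K, i, j => by
    simp only [kron_zero_apply]
    constructor <;> simp only [Nat.pow_zero, Fin.sum_univ_one, Fin.prod_univ_zero] <;>
      split_ifs <;> simp
  -- A cut at `K` runs through one of the two outer blocks and takes the other whole or not at all.
  -- Let `T`, `S` be the inner sums before and after the cut and `A = T + S` the full one. The outer
  -- products overlap only in the block `x = y = 1`; there the sums are reduced to convex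
  -- combinations with weights `u ^ 2`, `v ^ 2`. This is why initial sums and tails are bounded
  -- together.
  | n + 1, a, b, ε, ha, hab, hε, K, i, j => by
    have ih := abs_partial_sum_kron_rot_le n (fun k => ha k.castSucc) (fun k => hab k.castSucc)
      fun k => hε k.castSucc
    revert i j
    simp only [forall_blockIndex]
    intro x i y j
    simp only [sum_blockIndex, kron_blockIndex, blockIndex_val, Fin.prod_univ_castSucc]
    set u := a (Fin.last n)
    set v := b (Fin.last n)
    set e := ε (Fin.last n)
    have hu : u ≠ 0 := ha _
    have huv : u ^ 2 + v ^ 2 = 1 := hab _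
    have he : |e| = 1 := hε _
    set M := ∏ k : Fin n, |a k.castSucc|⁻¹
    set f : Fin (2 ^ n) → ℝ := fun l =>
      kron n (fun k => rotL (a k.castSucc) (b k.castSucc) (ε k.castSucc)) i l *
        kron n (fun k => rotU (a k.castSucc) (b k.castSucc) (ε k.castSucc)) l j with hf
    have hsplit : ∀ K : ℕ, ∑ l, f l
        = (∑ l : Fin (2 ^ n), if l.val < K then f l else 0)
          + ∑ l : Fin (2 ^ n), if K ≤ l.val then f l else 0 := fun K => by
      rw [← Finset.sum_add_distrib]
      refine Finset.sum_congr rfl fun l _ => ?_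
      by_cases h : l.val < K
      · simp [h, not_le.2 h]
      · simp [h, not_lt.1 h]
    -- The cut at `2 ^ n` leaves out no index, so the induction hypothesis also bounds the full sum.
    have hA : |∑ l, f l| ≤ M := by
      have := (ih (2 ^ n) i j).1
      simpa using this
    have hmul : ∀ (z : Fin 2) (p : ℕ → Prop) [DecidablePred p],
        (∑ l : Fin (2 ^ n), if p l.val then rotL u v e x z *
          kron n (fun k => rotL (a k.castSucc) (b k.castSucc) (ε k.castSucc)) i l *
          (rotU u v e z y *
            kron n (fun k => rotU (a k.castSucc) (b k.castSucc) (ε k.castSucc)) l j) else 0)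
        = rotL u v e x z * rotU u v e z y * ∑ l : Fin (2 ^ n), if p l.val then f l else 0 := by
      intro z p _
      rw [Finset.mul_sum]
      refine Finset.sum_congr rfl fun l _ => ?_
      split_ifs
      · simp only [hf]
        ring
      · rw [mul_zero]
    have hbig := abs_rotL_mul_rotU_zero_le hu huv he x y
    have hbig' := abs_rotL_mul_rotU_one_le (a := u) (b := v) he x y
    have hrot : ∀ {x y : Fin 2}, x = 1 → y = 1 → rotL u v e x 0 * rotU u v e 0 y = e / u * -v ^ 2 ∧
        rotL u v e x 1 * rotU u v e 1 y = e / u := by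
      rintro x y rfl rfl
      constructor <;> simp [rotL, rotU]
      ring
    have heu : |e / u| ≤ |u|⁻¹ := by rw [abs_div, he, one_div]
    have hx0 : ∀ l : Fin (2 ^ n), l.val + 2 ^ n * ((0 : Fin 2) : ℕ) = l.val := by simp
    have hx1 : ∀ l : Fin (2 ^ n), l.val + 2 ^ n * ((1 : Fin 2) : ℕ) = l.val + 2 ^ n := by simp
    simp only [hx0, hx1]
    rcases le_total K (2 ^ n) with hK | hK
    · have hn1 : ∀ l : Fin (2 ^ n), ¬ (l.val + 2 ^ n < K) := fun l => by omega
      have hn2 : ∀ l : Fin (2 ^ n), K ≤ l.val + 2 ^ n := fun l => by omega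
      obtain ⟨hT, hS⟩ := ih K i j
      have h1 := hmul 1 (fun _ => True)
      simp only [if_true] at h1
      rw [hmul 0 (fun l => l < K), hmul 0 (fun l => K ≤ l)]
      simp only [hn1, hn2, if_true, if_false, Finset.sum_const_zero, add_zero, h1]
      refine ⟨abs_mul_le_inv_mul hbig hT, ?_⟩
      by_cases hxy : x = 1 ∧ y = 1
      · rw [(hrot hxy.1 hxy.2).1, (hrot hxy.1 hxy.2).2]
        have : ∀ S A : ℝ, e / u * -v ^ 2 * S + e / u * A = e / u * (A - v ^ 2 * S) := by
          intros; ring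
        rw [this]
        refine abs_mul_le_inv_mul heu ?_
        -- `A - v ^ 2 * S = u ^ 2 * A + v ^ 2 * T`.
        have h2 := abs_convex_comb_le huv hA hT
        convert h2 using 2
        rw [hsplit K]
        linear_combination (∑ l : Fin (2 ^ n), if l.val < K then f l else 0) * (-huv)
          + (∑ l : Fin (2 ^ n), if K ≤ l.val then f l else 0) * (-huv)
      · rw [rotL_mul_rotU_one_eq_zero hxy, zero_mul, add_zero]
        exact abs_mul_le_inv_mul hbig hS
    · have hn1 : ∀ l : Fin (2 ^ n), l.val + 2 ^ n < K ↔ l.val < K - 2 ^ n := fun l => by omega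
      have hn2 : ∀ l : Fin (2 ^ n), K ≤ l.val + 2 ^ n ↔ K - 2 ^ n ≤ l.val := fun l => by omega
      have hn3 : ∀ l : Fin (2 ^ n), l.val < K := fun l => l.2.trans_le hK
      have hn4 : ∀ l : Fin (2 ^ n), ¬ (K ≤ l.val) := fun l => not_le.2 (hn3 l)
      obtain ⟨hT, hS⟩ := ih (K - 2 ^ n) i j
      have h1 := hmul 0 (fun _ => True)
      simp only [if_true] at h1
      simp only [hn1, hn2]
      rw [hmul 1 (fun l => l < K - 2 ^ n), hmul 1 (fun l => K - 2 ^ n ≤ l)]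
      simp only [hn3, hn4, if_true, if_false, Finset.sum_const_zero, zero_add, h1]
      refine ⟨?_, abs_mul_le_inv_mul hbig' hS⟩
      by_cases hxy : x = 1 ∧ y = 1
      · rw [(hrot hxy.1 hxy.2).1, (hrot hxy.1 hxy.2).2]
        have : ∀ T A : ℝ, e / u * -v ^ 2 * A + e / u * T = e / u * (T - v ^ 2 * A) := by
          intros; ring
        rw [this]
        refine abs_mul_le_inv_mul heu ?_
        -- `T - v ^ 2 * A = u ^ 2 * T + v ^ 2 * (-S)`.
        have h2 := abs_convex_comb_le huv hT ((abs_neg _).trans_le hS)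
        convert h2 using 2
        rw [hsplit (K - 2 ^ n)]
        linear_combination (∑ l : Fin (2 ^ n), if l.val < K - 2 ^ n then f l else 0) * (-huv)
      · rw [rotL_mul_rotU_one_eq_zero hxy, zero_mul, add_zero]
        exact abs_mul_le_inv_mul hbig hA

theorem iSup_maxNorm_geIter_kron_rot (ha : ∀ k, a k ≠ 0) (hab : ∀ k, a k ^ 2 + b k ^ 2 = 1)
    (hε : ∀ k, |ε k| = 1) :
    (⨆ k : Fin (2 ^ n), maxNorm (geIter (kron n fun k => rot (a k) (b k) (ε k)) k))
      = ∏ k, |a k|⁻¹ := by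
  have hLU := isLU_kron_rot (ε := ε) ha hab
  have hU : PivotsNeZero (kron n fun k => rotU (a k) (b k) (ε k)) :=
    fun k _ => kron_rotU_diag_ne_zero ha hε k
  have h0 : 0 ≤ ∏ k, |a k|⁻¹ := Finset.prod_nonneg fun k _ => by positivity
  refine le_antisymm (ciSup_le fun K => maxNorm_le h0 fun i j => ?_) ?_
  · rw [hLU.geIter_eq hU K K.2.le]
    split_ifs
    -- A finished row `i` is a row of `U`, that is, the tail cut at `i` itself.
    · rw [← hLU.tail_sum_row, Finset.sum_filter]
      exact (abs_partial_sum_kron_rot_le n ha hab hε i i j).2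
    · rw [Finset.sum_filter]
      exact (abs_partial_sum_kron_rot_le n ha hab hε K i j).2
  · have h := maxNorm_geIter_le_iSup (kron n fun k => rot (a k) (b k) (ε k))
      ⟨2 ^ n - 1, Nat.sub_lt (by positivity) one_pos⟩
    refine le_trans (le_of_eq ?_) h
    have : maxNorm (genpU (kron n fun k => rot (a k) (b k) (ε k))) = ∏ k, |a k|⁻¹ := by
      rw [hLU.genpU_eq hU, maxNorm_kron]
      exact Finset.prod_congr rfl fun k _ => maxNorm_rotU (ha k) (hab k) (hε k)
    exact this.symm

/-- Each factor contributes `max 1 |b/a| * |a|⁻¹ / max |a| |b| = 1 / a ^ 2`, which is `1 + (b/a) ^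
2` by normalization. -/
theorem rhoMax_kron_rot (ha : ∀ k, a k ≠ 0) (hab : ∀ k, a k ^ 2 + b k ^ 2 = 1)
    (hε : ∀ k, |ε k| = 1) :
    rhoMax (kron n fun k => rot (a k) (b k) (ε k)) = ∏ k, (1 + |b k / a k| ^ 2) := by
  have hLU := isLU_kron_rot (ε := ε) ha hab
  rw [rhoMax, iSup_maxNorm_geIter_kron_rot ha hab hε,
    hLU.genpL_eq fun k _ => kron_rotU_diag_ne_zero ha hε k, maxNorm_kron, maxNorm_kron,
    ← Finset.prod_mul_distrib, ← Finset.prod_div_distrib]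
  refine Finset.prod_congr rfl fun k _ => ?_
  rw [maxNorm_rot (hε k), maxNorm_rotL (hε k)]
  have ha' := abs_pos.2 (ha k)
  have h1 : max |a k| |b k| = max 1 |b k / a k| * |a k| := by
    rw [max_mul_of_nonneg _ _ (abs_nonneg _), abs_div, div_mul_cancel₀ _ ha'.ne', one_mul]
  have h2 : 0 < max 1 |b k / a k| := lt_max_of_lt_left one_pos
  have h3 : 1 + |b k / a k| ^ 2 = (|a k| ^ 2)⁻¹ := by
    rw [sq_abs, sq_abs, div_pow]
    have := ha k
    field_simp
    linear_combination hab k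
  rw [h1, h3]
  field_simp

theorem rhoO_kron_rot (ha : ∀ k, a k ≠ 0) (hab : ∀ k, a k ^ 2 + b k ^ 2 = 1)
    (hε : ∀ k, |ε k| = 1) :
    rhoO (kron n fun k => rot (a k) (b k) (ε k))
      = ∏ k, (1 + 2 * |b k / a k| ^ 2 / (1 + |b k / a k|)) := by
  have hLU := isLU_kron_rot (ε := ε) ha hab
  have hU : PivotsNeZero (kron n fun k => rotU (a k) (b k) (ε k)) :=
    fun k _ => kron_rotU_diag_ne_zero ha hε k
  rw [rhoO, hLU.genpL_eq hU, hLU.genpU_eq hU, kron_map_abs, kron_map_abs, kron_mul,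
    linfNorm_kron, linfNorm_kron, ← Finset.prod_div_distrib]
  refine Finset.prod_congr rfl fun k _ => ?_
  rw [linfNorm_rot (hε k), linfNorm_abs_rotL_mul_abs_rotU (ha k) (hab k) (hε k), abs_div]
  have ha' := abs_pos.2 (ha k)
  have hb' := abs_nonneg (b k)
  have h := hab k
  rw [← sq_abs, ← sq_abs (b k)] at h
  have h4 : 0 < |a k| + |b k| := by linarith
  field_simp
  linear_combination -h

theorem rhoInf_kron_rot (ha : ∀ k, a k ≠ 0) (hab : ∀ k, a k ^ 2 + b k ^ 2 = 1)
    (hε : ∀ k, |ε k| = 1) :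
    rhoInf (kron n fun k => rot (a k) (b k) (ε k))
      = ∏ k, (1 + max |b k / a k| (|b k / a k| ^ 2)) := by
  have hLU := isLU_kron_rot (ε := ε) ha hab
  have hU : PivotsNeZero (kron n fun k => rotU (a k) (b k) (ε k)) :=
    fun k _ => kron_rotU_diag_ne_zero ha hε k
  rw [rhoInf, hLU.genpL_eq hU, hLU.genpU_eq hU, linfNorm_kron, linfNorm_kron, linfNorm_kron,
    ← Finset.prod_mul_distrib, ← Finset.prod_div_distrib]
  refine Finset.prod_congr rfl fun k _ => ?_
  rw [linfNorm_rot (hε k), linfNorm_rotL (hε k), linfNorm_rotU (hε k), abs_div]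
  have ha' := abs_pos.2 (ha k)
  have hb' := abs_nonneg (b k)
  have h := hab k
  rw [← sq_abs, ← sq_abs (b k)] at h
  have h4 : 0 < |a k| + |b k| := by linarith
  -- Normalization gives `|a|⁻¹ = |a| + |b| ^ 2 / |a|`, so `|a|` can be pulled out of the maximum.
  have h5 : max (|a k| + |b k|) |a k|⁻¹
      = |a k| * max (1 + |b k| / |a k|) (1 + (|b k| / |a k|) ^ 2) := by
    rw [mul_max_of_nonneg _ _ ha'.le]
    congr 1
    · field_simp
    · field_simp
      linear_combination -h
  rw [h5, max_add_add_left]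
  field_simp

end KronRot

/-! ## Laws of the tangents -/

/-- The law of `|X|` for `X` standard Cauchy. -/
noncomputable def absCauchy : Measure ℝ := (cauchyMeasure 0 1).map (fun x => |x|)

instance isProbabilityMeasure_absCauchy : IsProbabilityMeasure absCauchy :=
  Measure.isProbabilityMeasure_map (by fun_prop)

theorem cauchyMeasure_eq_withDensity :
    cauchyMeasure 0 1 = volume.withDensity
      (fun x : ℝ => ENNReal.ofReal (Real.pi⁻¹ * (1 + x ^ 2)⁻¹)) := by
  rw [cauchyMeasure_of_scale_ne_zero _ one_ne_zero]
  congr 1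
  ext x
  rw [cauchyPDF_def, cauchyPDFReal_def]
  simp [add_comm]

instance nullSingletonClass_cauchyMeasure : NullSingletonClass (cauchyMeasure 0 1) := by
  rw [cauchyMeasure_eq_withDensity]
  infer_instance

theorem cauchyMeasure_Icc {a b : ℝ} (hab : a ≤ b) :
    cauchyMeasure 0 1 (Set.Icc a b)
      = ENNReal.ofReal (Real.pi⁻¹ * (Real.arctan b - Real.arctan a)) := by
  have hc : Continuous fun x : ℝ => Real.pi⁻¹ * (1 + x ^ 2)⁻¹ :=
    continuous_const.mul ((by fun_prop : Continuous fun x : ℝ => 1 + x ^ 2).inv₀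
      fun x => by positivity)
  rw [← measure_congr Ioc_ae_eq_Icc, cauchyMeasure_eq_withDensity,
    withDensity_apply _ measurableSet_Ioc, ← ofReal_integral_eq_lintegral_ofReal,
    ← intervalIntegral.integral_of_le hab, intervalIntegral.integral_const_mul,
    integral_inv_one_add_sq]
  · exact (hc.integrableOn_Icc).mono_set Set.Ioc_subset_Icc_self
  · exact ae_of_all _ fun x => by positivity

theorem cauchyMeasure_abs_le {x : ℝ} (hx : 0 ≤ x) :
    cauchyMeasure 0 1 {t | |t| ≤ x} = ENNReal.ofReal (2 / Real.pi * Real.arctan x) := by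
  have : {t : ℝ | |t| ≤ x} = Set.Icc (-x) x := by
    ext t
    exact abs_le (a := t)
  rw [this, cauchyMeasure_Icc (by linarith), Real.arctan_neg]
  congr 1
  ring

theorem absCauchy_Iic (x : ℝ) : absCauchy (Set.Iic x) = cauchyMeasure 0 1 {t | |t| ≤ x} :=
  Measure.map_apply (by fun_prop) measurableSet_Iic

theorem abs_tan_le_iff {φ x : ℝ} (h1 : -(Real.pi / 2) < φ) (h2 : φ < Real.pi / 2) :
    |Real.tan φ| ≤ x ↔ |φ| ≤ Real.arctan x := by
  rw [abs_le, abs_le, ← Real.arctan_neg]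
  conv_rhs => rw [← Real.arctan_tan h1 h2, Real.arctan_le_arctan_iff, Real.arctan_le_arctan_iff]

instance isProbabilityMeasure_uniformAngle : IsProbabilityMeasure uniformAngle := by
  refine cond_isProbabilityMeasure_of_finite ?_ ?_
  · simp [Real.pi_pos]
  · rw [Real.volume_Ico]
    exact ENNReal.ofReal_ne_top

theorem uniformAngle_absolutelyContinuous : uniformAngle ≪ volume :=
  cond_absolutelyContinuous

theorem measurable_tan : Measurable Real.tan := by
  have : Real.tan = fun x => Real.sin x / Real.cos x := funext Real.tan_eq_sin_div_cos
  rw [this]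
  fun_prop

/-- By `π`-periodicity the set is, up to null sets, the part of `[0, 2π)` within `α = arctan x` of
`0`, `π` or `2π`, of length `α + 2α + α`. -/
theorem volume_abs_tan_le {x : ℝ} (hx : 0 ≤ x) :
    volume (Set.Ico 0 (2 * Real.pi) ∩ {θ | |Real.tan θ| ≤ x})
      = ENNReal.ofReal (4 * Real.arctan x) := by
  set α := Real.arctan x with hα
  have hα0 : 0 ≤ α := Real.arctan_nonneg.2 hx
  have hα1 : α < Real.pi / 2 := Real.arctan_lt_pi_div_two x
  have hpi := Real.pi_pos
  have hE : (Set.Ico 0 (2 * Real.pi) ∩ {θ | |Real.tan θ| ≤ x} : Set ℝ)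
      =ᵐ[volume] (Set.Icc 0 α ∪ Set.Icc (Real.pi - α) (Real.pi + α)
        ∪ Set.Ico (2 * Real.pi - α) (2 * Real.pi) : Set ℝ) := by
    -- At the two poles `Real.tan` has the default value `0`, so they lie in the left-hand set and
    -- have to be discarded.
    have hnull : ∀ᵐ θ : ℝ, θ ∉ ({Real.pi / 2, 3 * Real.pi / 2} : Set ℝ) :=
      measure_eq_zero_iff_ae_notMem.1 ((Set.toFinite _).measure_zero _)
    filter_upwards [hnull] with θ hθ
    simp only [Set.mem_insert_iff, Set.mem_singleton_iff, not_or] at hθ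
    refine propext ?_
    change (θ ∈ Set.Ico 0 (2 * Real.pi) ∩ {θ | |Real.tan θ| ≤ x} ↔ θ ∈ Set.Icc 0 α ∪
      Set.Icc (Real.pi - α) (Real.pi + α) ∪ Set.Ico (2 * Real.pi - α) (2 * Real.pi))
    simp only [Set.mem_inter_iff, Set.mem_Ico, Set.mem_ofPred_eq, Set.mem_union, Set.mem_Icc]
    rcases lt_or_gt_of_ne hθ.1 with h1 | h1
    · by_cases h0 : 0 ≤ θ
      · rw [abs_tan_le_iff (by linarith) h1, abs_of_nonneg h0]
        constructor
        · rintro ⟨-, h⟩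
          exact Or.inl (Or.inl ⟨h0, h⟩)
        · rintro ((h | h) | h)
          · exact ⟨⟨h0, by linarith⟩, h.2⟩
          · linarith
          · linarith
      · constructor
        · rintro ⟨h, -⟩
          exact absurd h.1 h0
        · rintro ((h | h) | h)
          · exact absurd h.1 h0
          · linarith
          · linarith
    · rcases lt_or_gt_of_ne hθ.2 with h2 | h2
      · rw [← Real.tan_sub_pi, abs_tan_le_iff (by linarith) (by linarith), abs_le]
        constructor
        · rintro ⟨-, h⟩
          exact Or.inl (Or.inr ⟨by linarith, by linarith⟩)
        · rintro ((h | h) | h)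
          · linarith
          · exact ⟨⟨by linarith, by linarith⟩, by linarith, by linarith⟩
          · linarith
      · by_cases h3 : θ < 2 * Real.pi
        · rw [← Real.tan_sub_pi, ← Real.tan_sub_pi,
            abs_tan_le_iff (by linarith) (by linarith), abs_le]
          constructor
          · rintro ⟨-, h⟩
            exact Or.inr ⟨by linarith, h3⟩
          · rintro ((h | h) | h)
            · linarith
            · linarith
            · exact ⟨⟨by linarith, h3⟩, by linarith, by linarith⟩
        · constructor
          · rintro ⟨h, -⟩
            exact absurd h.2 h3
          · rintro ((h | h) | h)
            · linarith
            · linarith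
            · exact absurd h.2 h3
  rw [measure_congr hE, measure_union _ measurableSet_Ico, measure_union _ measurableSet_Icc,
    Real.volume_Icc, Real.volume_Icc, Real.volume_Ico, ← ENNReal.ofReal_add, ← ENNReal.ofReal_add]
  · congr 1
    ring
  all_goals try linarith
  · rw [Set.disjoint_left]
    rintro θ h h'
    simp only [Set.mem_Icc] at h h'
    linarith
  · rw [Set.disjoint_left]
    rintro θ h h'
    simp only [Set.mem_union, Set.mem_Icc, Set.mem_Ico] at h h'
    rcases h with h | h <;> linarith

/-- Both distribution functions are `(2 / π) * arctan x` for `x ≥ 0`. -/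
theorem map_abs_tan_uniformAngle : uniformAngle.map (fun θ => |Real.tan θ|) = absCauchy := by
  have hm : Measurable fun θ => |Real.tan θ| := measurable_tan.abs
  have : IsProbabilityMeasure (uniformAngle.map fun θ => |Real.tan θ|) :=
    Measure.isProbabilityMeasure_map hm.aemeasurable
  refine Measure.ext_of_Iic _ _ fun x => ?_
  rw [absCauchy_Iic, Measure.map_apply hm measurableSet_Iic]
  rcases lt_or_ge x 0 with hx | hx
  · have h1 : (fun θ => |Real.tan θ|) ⁻¹' Set.Iic x = ∅ :=
      Set.eq_empty_of_forall_notMem fun θ h => not_le.2 hx ((abs_nonneg _).trans h)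
    have h2 : {t : ℝ | |t| ≤ x} = ∅ :=
      Set.eq_empty_of_forall_notMem fun θ h => not_le.2 hx ((abs_nonneg _).trans h)
    rw [h1, h2, measure_empty, measure_empty]
  · have hpi := Real.pi_pos
    rw [uniformAngle, cond_apply measurableSet_Ico, cauchyMeasure_abs_le hx, Real.volume_Ico]
    have := volume_abs_tan_le hx
    rw [show (fun θ => |Real.tan θ|) ⁻¹' Set.Iic x = {θ | |Real.tan θ| ≤ x} from rfl, this,
      ← ENNReal.ofReal_inv_of_pos (by linarith), ← ENNReal.ofReal_mul (inv_nonneg.2 (by linarith))]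
    congr 1
    field_simp
    ring

theorem cauchyMeasure_le_abs {x : ℝ} (hx : 0 < x) :
    cauchyMeasure 0 1 {t | x ≤ |t|} = ENNReal.ofReal (2 / Real.pi * Real.arctan x⁻¹) := by
  have hpi := Real.pi_pos
  have hc : {t : ℝ | x ≤ |t|} = (Set.Ioo (-x) x)ᶜ := by
    ext t
    simp only [Set.mem_ofPred_eq, Set.mem_compl_iff, Set.mem_Ioo]
    rw [← abs_lt, not_lt]
  rw [hc, prob_compl_eq_one_sub measurableSet_Ioo, measure_congr Ioo_ae_eq_Icc,
    cauchyMeasure_Icc (by linarith), Real.arctan_neg, ← ENNReal.ofReal_one,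
    ← ENNReal.ofReal_sub, Real.arctan_inv_of_pos hx]
  · congr 1
    field_simp
    ring
  · have := Real.arctan_nonneg.2 hx.le
    have : 0 ≤ Real.arctan x - -Real.arctan x := by linarith
    positivity

/-- For `0 < x < 1` the event `min |X| |X|⁻¹ ≤ x` is the disjoint union of `|X| ≤ x` and `|X| ≥
1/x`, which have equal probability. Conditioning on `|X| ≤ 1`, of probability `1/2`, doubles the
first in the same way. -/
theorem map_min_inv_absCauchy : absCauchy.map (fun t => min t t⁻¹) = condAbsCauchy := by
  have hm : Measurable fun t : ℝ => min t t⁻¹ := measurable_id.min measurable_inv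
  have hs : MeasurableSet {t : ℝ | |t| ≤ 1} := measurableSet_le (by fun_prop) (by fun_prop)
  have hpi := Real.pi_pos
  have hcomp : absCauchy.map (fun t => min t t⁻¹)
      = (cauchyMeasure 0 1).map (fun t => min |t| |t|⁻¹) :=
    Measure.map_map hm (by fun_prop)
  have hm' : Measurable fun t : ℝ => min |t| |t|⁻¹ := hm.comp (by fun_prop)
  have : IsProbabilityMeasure (absCauchy.map fun t => min t t⁻¹) :=
    Measure.isProbabilityMeasure_map hm.aemeasurable
  refine Measure.ext_of_Iic _ _ fun x => ?_
  have hhalf : (cauchyMeasure 0 1 {t : ℝ | |t| ≤ 1}) = 2⁻¹ := by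
    rw [cauchyMeasure_abs_le zero_le_one, Real.arctan_one,
      show 2 / Real.pi * (Real.pi / 4) = 2⁻¹ by field_simp; norm_num,
      ENNReal.ofReal_inv_of_pos two_pos, ENNReal.ofReal_ofNat]
  rw [hcomp, condAbsCauchy, Measure.map_apply hm' measurableSet_Iic,
    Measure.map_apply (by fun_prop) measurableSet_Iic, cond_apply hs, hhalf, inv_inv]
  rcases lt_or_ge x 0 with hx | hx
  · have h1 : (fun t : ℝ => min |t| |t|⁻¹) ⁻¹' Set.Iic x = ∅ :=
      Set.eq_empty_of_forall_notMem fun t h => not_le.2 hx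
        ((le_min (abs_nonneg _) (by positivity)).trans h)
    have h2 : (fun t : ℝ => |t|) ⁻¹' Set.Iic x = ∅ :=
      Set.eq_empty_of_forall_notMem fun t h => not_le.2 hx ((abs_nonneg _).trans h)
    rw [h1, h2, Set.inter_empty, measure_empty, mul_zero]
  rcases lt_or_ge x 1 with hx1 | hx1
  · have h2 : {t : ℝ | |t| ≤ 1} ∩ (fun t => |t|) ⁻¹' Set.Iic x = {t | |t| ≤ x} := by
      ext t
      simp only [Set.mem_inter_iff, Set.mem_ofPred_eq, Set.mem_preimage, Set.mem_Iic]
      constructor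
      · exact fun h => h.2
      · exact fun h => ⟨h.trans hx1.le, h⟩
    rw [h2]
    -- At `x = 0` the description by `x⁻¹ ≤ |t|` breaks down because `0⁻¹ = 0`.
    rcases hx.eq_or_lt with rfl | hx0
    · have h1 : (fun t : ℝ => min |t| |t|⁻¹) ⁻¹' Set.Iic 0 = {t | |t| ≤ 0} := by
        ext t
        simp
      rw [h1, cauchyMeasure_abs_le le_rfl]
      simp
    · have h1 : (fun t : ℝ => min |t| |t|⁻¹) ⁻¹' Set.Iic x
          = {t | |t| ≤ x} ∪ {t | x⁻¹ ≤ |t|} := by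
        ext t
        simp only [Set.mem_preimage, Set.mem_Iic, min_le_iff, Set.mem_union, Set.mem_ofPred_eq]
        rcases eq_or_ne t 0 with rfl | ht
        · simp [hx]
        · rw [inv_le_comm₀ (abs_pos.2 ht) hx0]
      have hx1' : x < x⁻¹ := hx1.trans ((one_lt_inv₀ hx0).2 hx1)
      rw [h1, measure_union, cauchyMeasure_abs_le hx, cauchyMeasure_le_abs (inv_pos.2 hx0),
        inv_inv, two_mul]
      · rw [Set.disjoint_left]
        intro t h h'
        exact absurd (h'.trans h) (not_le.2 hx1')
      · exact measurableSet_le (by fun_prop) (by fun_prop)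
  · have h1 : (fun t : ℝ => min |t| |t|⁻¹) ⁻¹' Set.Iic x = Set.univ := by
      refine Set.eq_univ_of_forall fun t => ?_
      refine le_trans ?_ hx1
      rcases le_total |t| 1 with h | h
      · exact (min_le_left _ _).trans h
      · exact (min_le_right _ _).trans (inv_le_one_of_one_le₀ h)
    have h2 : {t : ℝ | |t| ≤ 1} ∩ (fun t => |t|) ⁻¹' Set.Iic x = {t | |t| ≤ 1} :=
      Set.inter_eq_left.2 fun t (h : |t| ≤ 1) => h.trans hx1
    rw [h1, h2, hhalf, measure_univ, ENNReal.mul_inv_cancel two_ne_zero ENNReal.ofNat_ne_top]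

/-! ## Haar-butterfly matrices -/

instance borelSpace_matrix {m k : ℕ} : BorelSpace (Matrix (Fin m) (Fin k) ℝ) :=
  inferInstanceAs (BorelSpace (Fin m → Fin k → ℝ))

theorem continuous_kron_apply {X : Type*} [TopologicalSpace X] :
    ∀ (n : ℕ) {F : X → Fin n → Matrix (Fin 2) (Fin 2) ℝ},
      (∀ k x y, Continuous fun t => F t k x y) → ∀ i j, Continuous fun t => kron n (F t) i j
  | 0, F, _, i, j => by
    simp only [kron_zero_apply]
    exact continuous_const
  | n + 1, F, hF, i, j => by
    revert i j
    simp only [forall_blockIndex, kron_blockIndex]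
    exact fun x i y j => (hF _ x y).mul (continuous_kron_apply n (fun k => hF k.castSucc) i j)

theorem continuous_butterfly (n : ℕ) : Continuous (butterfly n) := by
  refine continuous_matrix fun i j => ?_
  simp only [butterfly_eq_kron]
  refine continuous_kron_apply n (fun k x y => ?_) i j
  fin_cases x <;> fin_cases y <;> simp only [rot, Fin.zero_eta, Fin.mk_one, Matrix.of_apply,
    Matrix.cons_val', Matrix.cons_val_zero, Matrix.cons_val_one, Matrix.cons_val_fin_one] <;>
    fun_prop

/-- Take the row whose binary digit is one in place `k` and zero elsewhere: in the quotient all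
factors but the `k`-th cancel. -/
theorem exists_kron_div_eq : ∀ (n : ℕ) (k : Fin n), ∃ i : Fin (2 ^ n),
    ∀ F : Fin n → Matrix (Fin 2) (Fin 2) ℝ, (∀ k, F k 0 0 ≠ 0) →
      kron n F i 0 / kron n F 0 0 = F k 1 0 / F k 0 0
  | n + 1, k => by
    have h0 : (0 : Fin (2 ^ (n + 1))) = blockIndex n (0, 0) := Fin.ext (by simp [blockIndex_val])
    have hne : ∀ (n : ℕ) (F : Fin n → Matrix (Fin 2) (Fin 2) ℝ), (∀ k, F k 0 0 ≠ 0) →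
        kron n F 0 0 ≠ 0 := by
      intro n
      induction n with
      | zero => exact fun F _ => by rw [kron_zero_apply]; exact one_ne_zero
      | succ n ih =>
        intro F hF
        have h0 : (0 : Fin (2 ^ (n + 1))) = blockIndex n (0, 0) :=
          Fin.ext (by simp [blockIndex_val])
        rw [h0, kron_blockIndex]
        exact mul_ne_zero (hF _) (ih _ fun k => hF k.castSucc)
    induction k using Fin.lastCases with
    | last =>
      refine ⟨blockIndex n (1, 0), fun F hF => ?_⟩
      rw [h0, kron_blockIndex, kron_blockIndex,
        mul_div_mul_right _ _ (hne n _ fun k => hF k.castSucc)]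
    | cast k =>
      obtain ⟨i, hi⟩ := exists_kron_div_eq n k
      refine ⟨blockIndex n (0, i), fun F hF => ?_⟩
      rw [h0, kron_blockIndex, kron_blockIndex, mul_div_mul_left _ _ (hF _),
        hi _ fun k => hF k.castSucc]

/-- The tangents of the angles can be read off measurably from a butterfly matrix. -/
theorem exists_measurable_abs_tan (n : ℕ) :
    ∃ T : Matrix (Fin (2 ^ n)) (Fin (2 ^ n)) ℝ → Fin n → ℝ, Measurable T ∧
      ∀ θ, (∀ k, Real.cos (θ k) ≠ 0) → T (butterfly n θ) = fun k => |Real.tan (θ k)| := by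
  choose r hr using exists_kron_div_eq n
  refine ⟨fun A k => |A (r k) 0 / A 0 0|, ?_, fun θ hθ => ?_⟩
  · have hm : ∀ i j : Fin (2 ^ n),
        Measurable fun A : Matrix (Fin (2 ^ n)) (Fin (2 ^ n)) ℝ => A i j :=
      fun i j => (measurable_pi_apply j).comp (measurable_pi_apply i)
    exact measurable_pi_lambda _ fun k => ((hm _ _).div (hm _ _)).abs
  · ext k
    have h := hr k (fun k => rot (Real.cos (θ k)) (Real.sin (θ k)) 1)
      fun k => by simpa [rot] using hθ k
    rw [butterfly_eq_kron, Real.tan_eq_sin_div_cos]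
    refine (congrArg abs h).trans ?_
    simp [rot, abs_div]

/-- An angle is generic if it is not a multiple of `π / 4`. -/
def IsGenericAngle (θ : ℝ) : Prop := Real.sin (4 * θ) ≠ 0

theorem sin_four_mul (θ : ℝ) : Real.sin (4 * θ)
    = 4 * Real.sin θ * Real.cos θ * (Real.cos θ ^ 2 - Real.sin θ ^ 2) := by
  rw [show 4 * θ = 2 * (2 * θ) by ring, Real.sin_two_mul, Real.sin_two_mul, Real.cos_two_mul']
  ring

namespace IsGenericAngle

variable {θ : ℝ}

theorem cos_ne_zero (h : IsGenericAngle θ) : Real.cos θ ≠ 0 := fun h' => h (by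
  rw [sin_four_mul, h']
  ring)

theorem sin_ne_zero (h : IsGenericAngle θ) : Real.sin θ ≠ 0 := fun h' => h (by
  rw [sin_four_mul, h']
  ring)

theorem abs_sin_ne_abs_cos (h : IsGenericAngle θ) : |Real.sin θ| ≠ |Real.cos θ| := fun h' => h (by
  rw [sin_four_mul, ← sq_abs (Real.sin θ), h', sq_abs, sub_self, mul_zero])

end IsGenericAngle

theorem ae_isGenericAngle : ∀ᵐ θ ∂uniformAngle, IsGenericAngle θ := by
  refine uniformAngle_absolutelyContinuous.ae_le ?_
  have hc : (Set.range fun k : ℤ => (k : ℝ) * Real.pi / 4).Countable := Set.countable_range _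
  refine measure_mono_null (fun θ h => ?_) (hc.measure_zero volume)
  have h' : Real.sin (4 * θ) = 0 := not_not.1 h
  obtain ⟨k, hk⟩ := Real.sin_eq_zero_iff.1 h'
  exact ⟨k, by simp only [hk]; ring⟩

theorem ae_pi_uniformAngle {n : ℕ} {p : ℝ → Prop} (h : ∀ᵐ θ ∂uniformAngle, p θ) :
    ∀ᵐ θ ∂Measure.pi fun _ : Fin n => uniformAngle, ∀ k, p (θ k) :=
  ae_all_iff.2 fun k =>
    (Measure.quasiMeasurePreserving_eval (fun _ : Fin n => uniformAngle) k).ae h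

/-- Transferring an almost sure statement to the image measure needs a measurable set. The generic
angles in `[0, 2π)` are covered by the compact sets `K N`, whose images are compact and hence Borel.
-/
theorem ae_haarButterfly (n : ℕ) :
    ∀ᵐ A ∂haarButterfly n, ∃ θ, (∀ k, IsGenericAngle (θ k)) ∧ A = butterfly n θ := by
  set K : ℕ → Set (Fin n → ℝ) := fun N =>
    Set.univ.pi (fun _ => Set.Icc 0 (2 * Real.pi) ∩ {θ | 1 / ((N : ℝ) + 1) ≤ |Real.sin (4 * θ)|})
  have hK : ∀ N, IsCompact (K N) := fun N => isCompact_univ_pi fun _ =>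
    isCompact_Icc.inter_right (isClosed_le continuous_const (by fun_prop))
  have hmeas : MeasurableSet (⋃ N, butterfly n '' K N) :=
    MeasurableSet.iUnion fun N => ((hK N).image (continuous_butterfly n)).measurableSet
  have hae : ∀ᵐ A ∂haarButterfly n, A ∈ ⋃ N, butterfly n '' K N := by
    refine (ae_map_iff (p := fun A => A ∈ ⋃ N, butterfly n '' K N)
      (continuous_butterfly n).measurable.aemeasurable hmeas).2 ?_
    have h0 : ∀ᵐ θ ∂uniformAngle, IsGenericAngle θ ∧ θ ∈ Set.Ico 0 (2 * Real.pi) :=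
      ae_isGenericAngle.and (ae_cond_mem measurableSet_Ico)
    have h1 : ∀ᵐ θ ∂Measure.pi fun _ : Fin n => uniformAngle,
        ∀ k, IsGenericAngle (θ k) ∧ θ k ∈ Set.Ico 0 (2 * Real.pi) :=
      ae_pi_uniformAngle h0
    filter_upwards [h1] with θ hθ
    have h2 : ∃ δ > 0, ∀ k, δ ≤ |Real.sin (4 * θ k)| := by
      rcases isEmpty_or_nonempty (Fin n) with he | he
      · exact ⟨1, one_pos, fun k => he.elim k⟩
      · obtain ⟨k, hk⟩ := Finite.exists_min fun k => |Real.sin (4 * θ k)|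
        exact ⟨_, abs_pos.2 (hθ k).1, hk⟩
    obtain ⟨δ, hδ, hle⟩ := h2
    obtain ⟨N, hN⟩ := exists_nat_one_div_lt hδ
    exact Set.mem_iUnion.2 ⟨N, θ, fun k _ =>
      ⟨Set.Ico_subset_Icc_self (hθ k).2, hN.le.trans (hle k)⟩, rfl⟩
  filter_upwards [hae] with A hA
  obtain ⟨N, θ, hθ, rfl⟩ := Set.mem_iUnion.1 hA
  refine ⟨θ, fun k h => ?_, rfl⟩
  have := (hθ k trivial).2
  simp only [Set.mem_ofPred_eq, h, abs_zero] at this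
  exact absurd this (not_le.2 (by positivity))

theorem hasLaw_abs_tan {n : ℕ} {T : Matrix (Fin (2 ^ n)) (Fin (2 ^ n)) ℝ → Fin n → ℝ}
    (hT : Measurable T)
    (hTan : ∀ θ, (∀ k, Real.cos (θ k) ≠ 0) → T (butterfly n θ) = fun k => |Real.tan (θ k)|) :
    HasLaw T (Measure.pi fun _ => absCauchy) (haarButterfly n) where
  aemeasurable := hT.aemeasurable
  map_eq := by
    have hm : Measurable fun θ => |Real.tan θ| := measurable_tan.abs
    have hae : T ∘ butterfly n =ᵐ[Measure.pi fun _ => uniformAngle]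
        fun θ k => |Real.tan (θ k)| := by
      have : ∀ᵐ θ ∂Measure.pi fun _ : Fin n => uniformAngle, ∀ k, IsGenericAngle (θ k) :=
        ae_pi_uniformAngle ae_isGenericAngle
      filter_upwards [this] with θ hθ using hTan θ fun k => (hθ k).cos_ne_zero
    have : IsProbabilityMeasure (uniformAngle.map fun θ => |Real.tan θ|) :=
      Measure.isProbabilityMeasure_map hm.aemeasurable
    rw [haarButterfly, Measure.map_map hT (continuous_butterfly n).measurable,
      Measure.map_congr hae,
      Measure.pi_map_pi (f := fun _ θ => |Real.tan θ|) fun _ => hm.aemeasurable,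
      map_abs_tan_uniformAngle]

theorem hasLaw_min_inv (n : ℕ) :
    HasLaw (fun t (k : Fin n) => min (t k) (t k)⁻¹) (Measure.pi fun _ => condAbsCauchy)
      (Measure.pi fun _ => absCauchy) where
  aemeasurable := by fun_prop
  map_eq := by
    have hm : Measurable fun t : ℝ => min t t⁻¹ := measurable_id.min measurable_inv
    have : IsProbabilityMeasure (absCauchy.map fun t => min t t⁻¹) :=
      Measure.isProbabilityMeasure_map hm.aemeasurable
    rw [Measure.pi_map_pi (f := fun _ t => min t t⁻¹) fun _ => hm.aemeasurable,
      map_min_inv_absCauchy]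

/-- As `g` need only agree almost everywhere with `f ∘ T`, measurability of growth factors or of a
choice of pivots never has to be checked directly. -/
theorem identDistrib_of_hasLaw {Ω Ω' E : Type*} [MeasurableSpace Ω] [MeasurableSpace Ω']
    [MeasurableSpace E] {μ : Measure Ω} {ν : Measure Ω'} {P : Measure E} {T : Ω → E} {S : Ω' → E}
    (hT : HasLaw T P μ) (hS : HasLaw S P ν) {f : E → ℝ} (hf : Measurable f) {g : Ω → ℝ}
    (hg : ∀ᵐ ω ∂μ, g ω = f (T ω)) : IdentDistrib g (fun ω => f (S ω)) μ ν := by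
  have h : IdentDistrib T S μ ν :=
    ⟨hT.aemeasurable, hS.aemeasurable, hT.map_eq.trans hS.map_eq.symm⟩
  have h' := h.comp hf
  exact ⟨h'.aemeasurable_fst.congr (hg.mono fun _ h => h.symm), h'.aemeasurable_snd,
    (Measure.map_congr hg).trans h'.map_eq⟩

theorem isLU_butterfly {n : ℕ} {θ : Fin n → ℝ} (hθ : ∀ k, IsGenericAngle (θ k)) :
    GENPDefined (butterfly n θ) ∧
      IsLU (butterfly n θ) (genpL (butterfly n θ)) (genpU (butterfly n θ)) := by
  have h : GENPDefined (butterfly n θ) := by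
    rw [butterfly_eq_kron]
    exact (isLU_kron_rot (fun k => (hθ k).cos_ne_zero)
      fun k => Real.cos_sq_add_sin_sq (θ k)).genpDefined
        fun k _ => kron_rotU_diag_ne_zero (fun k => (hθ k).cos_ne_zero) (fun _ => abs_one) k
  exact ⟨h, h.isLU⟩

/-! ### Growth factors of butterfly matrices -/

section GrowthFactors

variable {n : ℕ} {θ : Fin n → ℝ}

theorem growthFactors_butterfly (hθ : ∀ k, IsGenericAngle (θ k)) :
    rhoMax (butterfly n θ) = ∏ k, (1 + |Real.tan (θ k)| ^ 2) ∧
    rhoO (butterfly n θ)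
      = ∏ k, (1 + 2 * |Real.tan (θ k)| ^ 2 / (1 + |Real.tan (θ k)|)) ∧
    rhoInf (butterfly n θ)
      = ∏ k, (1 + max |Real.tan (θ k)| (|Real.tan (θ k)| ^ 2)) := by
  have h1 := fun k => (hθ k).cos_ne_zero
  have h2 := fun k => Real.cos_sq_add_sin_sq (θ k)
  simp only [Real.tan_eq_sin_div_cos]
  rw [butterfly_eq_kron]
  exact ⟨rhoMax_kron_rot h1 h2 fun _ => abs_one, rhoO_kron_rot h1 h2 fun _ => abs_one,
    rhoInf_kron_rot h1 h2 fun _ => abs_one⟩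

/-- Swapping the rows in those factors whose tangent exceeds one in modulus. -/
theorem exists_submatrix_butterfly_eq (hθ : ∀ k, IsGenericAngle (θ k)) :
    ∃ (σ : Equiv.Perm (Fin (2 ^ n))) (a b ε : Fin n → ℝ), (∀ k, a k ≠ 0) ∧
      (∀ k, a k ^ 2 + b k ^ 2 = 1) ∧ (∀ k, |ε k| = 1) ∧ (∀ k, |b k| < |a k|) ∧
      (∀ k, |b k / a k| = min |Real.tan (θ k)| |Real.tan (θ k)|⁻¹) ∧
      (butterfly n θ).submatrix σ id = kron n fun k => rot (a k) (b k) (ε k) := by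
  have key : ∀ k, ∃ (δ : Equiv.Perm (Fin 2)) (a b ε : ℝ), a ≠ 0 ∧ a ^ 2 + b ^ 2 = 1 ∧ |ε| = 1 ∧
      |b| < |a| ∧ |b / a| = min |Real.tan (θ k)| |Real.tan (θ k)|⁻¹ ∧
      (rot (Real.cos (θ k)) (Real.sin (θ k)) 1).submatrix δ id = rot a b ε := by
    intro k
    have hc := abs_pos.2 (hθ k).cos_ne_zero
    have hs := abs_pos.2 (hθ k).sin_ne_zero
    have h1 := Real.cos_sq_add_sin_sq (θ k)
    rw [Real.tan_eq_sin_div_cos, abs_div]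
    rcases lt_or_gt_of_ne (hθ k).abs_sin_ne_abs_cos with h | h
    · refine ⟨1, Real.cos (θ k), Real.sin (θ k), 1, abs_pos.1 hc, h1, abs_one, h, ?_, rfl⟩
      have h2 : |Real.sin (θ k)| / |Real.cos (θ k)| < 1 := (div_lt_one hc).2 h
      rw [abs_div, min_eq_left]
      exact h2.le.trans ((one_lt_inv₀ (div_pos hs hc)).2 h2).le
    -- The swapped rotation `[[-sin, cos], [cos, sin]]` has determinant `-1`, which is why `rot`
    -- carries the sign `ε`.
    · refine ⟨Equiv.swap 0 1, -Real.sin (θ k), Real.cos (θ k), -1,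
        neg_ne_zero.2 (abs_pos.1 hs), by linear_combination h1, by simp, by rwa [abs_neg], ?_, ?_⟩
      · have h2 : |Real.cos (θ k)| / |Real.sin (θ k)| < 1 := (div_lt_one hs).2 h
        rw [abs_div, abs_neg, inv_div, min_eq_right]
        rw [← inv_div |Real.cos (θ k)|]
        exact h2.le.trans ((one_lt_inv₀ (div_pos hc hs)).2 h2).le
      · ext x y
        fin_cases x <;> fin_cases y <;> simp [rot]
  choose δ a b ε h1 h2 h3 h4 h5 h6 using key
  refine ⟨kronPerm n δ, a, b, ε, h1, h2, h3, h4, h5, ?_⟩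
  rw [butterfly_eq_kron, kron_submatrix_kronPerm]
  congr 1
  ext1 k
  exact h6 k

theorem growthFactors_pivoted_butterfly (hθ : ∀ k, IsGenericAngle (θ k)) {s : PivotStrategy}
    {p : Fin (2 ^ n) → Fin (2 ^ n) × Fin (2 ^ n)} (hp : s.IsRun (butterfly n θ) p) {y : Fin n → ℝ}
    (hy : ∀ k, y k = min |Real.tan (θ k)| |Real.tan (θ k)|⁻¹) :
    rhoMax (pivoted (butterfly n θ) p) = ∏ k, (1 + y k ^ 2) ∧
    rhoO (pivoted (butterfly n θ) p) = ∏ k, (1 + 2 * y k ^ 2 / (1 + y k)) ∧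
    rhoInf (pivoted (butterfly n θ) p) = ∏ k, (1 + max (y k) (y k ^ 2)) := by
  obtain ⟨σ, a, b, ε, h1, h2, h3, h4, h5, h6⟩ := exists_submatrix_butterfly_eq hθ
  have hd := isDominantLU_kron_rot h1 h2 h3 h4
  rw [← h6] at hd
  rw [hd.pivoted_eq hp, h6, rhoMax_kron_rot h1 h2 h3, rhoO_kron_rot h1 h2 h3,
    rhoInf_kron_rot h1 h2 h3]
  simp only [h5, hy, and_self]

theorem one_le_prod_one_add {f : Fin n → ℝ} (h : ∀ k, 0 ≤ f k) : 1 ≤ ∏ k, (1 + f k) := by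
  calc (1 : ℝ) = ∏ _k : Fin n, 1 := by simp
    _ ≤ _ := Finset.prod_le_prod (fun _ _ => zero_le_one) fun k _ => by linarith [h k]

theorem prod_one_add_le {f g : Fin n → ℝ} (h : ∀ k, 0 ≤ f k) (hfg : ∀ k, f k ≤ g k) :
    ∏ k, (1 + f k) ≤ ∏ k, (1 + g k) :=
  Finset.prod_le_prod (fun k _ => by linarith [h k]) fun k _ => by linarith [hfg k]

theorem two_mul_sq_div_le_max {t : ℝ} (ht : 0 ≤ t) : 2 * t ^ 2 / (1 + t) ≤ max t (t ^ 2) := by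
  rw [div_le_iff₀ (by linarith)]
  rcases le_total t 1 with h | h
  · calc 2 * t ^ 2 ≤ t * (1 + t) := by nlinarith
      _ ≤ _ := mul_le_mul_of_nonneg_right (le_max_left _ _) (by linarith)
  · calc 2 * t ^ 2 ≤ t ^ 2 * (1 + t) := by nlinarith [sq_nonneg t]
      _ ≤ _ := mul_le_mul_of_nonneg_right (le_max_right _ _) (by linarith)

theorem growthFactors_le_of_eq {A : Matrix (Fin (2 ^ n)) (Fin (2 ^ n)) ℝ} {y : Fin n → ℝ}
    (hy : ∀ k, 0 ≤ y k) (h1 : rhoMax A = ∏ k, (1 + y k ^ 2))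
    (h2 : rhoO A = ∏ k, (1 + 2 * y k ^ 2 / (1 + y k)))
    (h3 : rhoInf A = ∏ k, (1 + max (y k) (y k ^ 2))) :
    1 ≤ rhoMax A ∧ rhoMax A ≤ rhoInf A ∧ 1 ≤ rhoO A ∧ rhoO A ≤ rhoInf A := by
  have h4 : ∀ k, 0 ≤ 2 * y k ^ 2 / (1 + y k) := fun k => by have := hy k; positivity
  rw [h1, h2, h3]
  exact ⟨one_le_prod_one_add fun k => sq_nonneg _,
    prod_one_add_le (fun k => sq_nonneg _) fun k => le_max_right _ _, one_le_prod_one_add h4,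
    prod_one_add_le h4 fun k => two_mul_sq_div_le_max (hy k)⟩

/-- The first comparison is `1 + y ≤ 2` in each factor; in the second each factor is at most `2`. -/
theorem growthFactors_le_of_eq_of_le_one {A : Matrix (Fin (2 ^ n)) (Fin (2 ^ n)) ℝ}
    {y : Fin n → ℝ} (hy : ∀ k, 0 ≤ y k) (hy1 : ∀ k, y k ≤ 1)
    (h1 : rhoMax A = ∏ k, (1 + y k ^ 2)) (h2 : rhoO A = ∏ k, (1 + 2 * y k ^ 2 / (1 + y k)))
    (h3 : rhoInf A = ∏ k, (1 + max (y k) (y k ^ 2))) :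
    rhoMax A ≤ rhoO A ∧ rhoInf A ≤ 2 ^ n := by
  rw [h1, h2, h3]
  constructor
  · refine prod_one_add_le (fun k => sq_nonneg _) fun k => ?_
    rw [le_div_iff₀ (by linarith [hy k])]
    nlinarith [sq_nonneg (y k), hy1 k]
  · calc ∏ k, (1 + max (y k) (y k ^ 2)) ≤ ∏ _k : Fin n, (1 + 1 : ℝ) :=
          prod_one_add_le (fun k => le_max_of_le_left (hy k)) fun k =>
            max_le (hy1 k) (pow_le_one₀ (hy k) (hy1 k))
      _ = 2 ^ n := by
        rw [Finset.prod_const, Finset.card_univ, Fintype.card_fin]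
        norm_num

theorem min_inv_le_one {t : ℝ} : min t t⁻¹ ≤ 1 := by
  rcases le_total t 1 with h | h
  · exact (min_le_left _ _).trans h
  · exact (min_le_right _ _).trans (inv_le_one_of_one_le₀ h)

/-- Among all row and column orders, the one of partial pivoting has minimal max-norm growth. -/
theorem rhoMax_pivoted_butterfly_le (hθ : ∀ k, IsGenericAngle (θ k)) {s : PivotStrategy}
    {p : Fin (2 ^ n) → Fin (2 ^ n) × Fin (2 ^ n)} (hp : s.IsRun (butterfly n θ) p)
    (σ τ : Equiv.Perm (Fin (2 ^ n)))
    (h : GENPDefined (σ.permMatrix ℝ * butterfly n θ * τ.permMatrix ℝ)) :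
    rhoMax (pivoted (butterfly n θ) p) ≤
      rhoMax (σ.permMatrix ℝ * butterfly n θ * τ.permMatrix ℝ) := by
  obtain ⟨π, a, b, ε, h1, h2, h3, h4, -, h6⟩ := exists_submatrix_butterfly_eq hθ
  have hd := isDominantLU_kron_rot h1 h2 h3 h4
  rw [← h6] at hd
  have horth : butterfly n θ * (butterfly n θ).transpose = 1 := by
    rw [butterfly_eq_kron]
    exact kron_rot_mul_transpose (fun k => Real.cos_sq_add_sin_sq (θ k)) fun _ => abs_one
  rw [permMatrix_mul_mul_permMatrix_apply] at h ⊢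
  have h7 := h.inv_maxNorm_sq_le_rhoMax (by
    rw [Matrix.transpose_submatrix, Matrix.submatrix_mul_equiv, horth, Matrix.submatrix_one_equiv])
  refine le_trans (le_of_eq ?_) h7
  -- The lower bound becomes `∏ 1 / a_k ^ 2`, which is the growth factor after pivoting.
  have h8 : maxNorm (butterfly n θ) = ∏ k, |a k| := by
    rw [← maxNorm_submatrix _ π 1]
    change maxNorm ((butterfly n θ).submatrix π id) = _
    rw [h6, maxNorm_kron]
    exact Finset.prod_congr rfl fun k _ => by rw [maxNorm_rot (h3 k), max_eq_left (h4 k).le]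
  rw [hd.pivoted_eq hp, maxNorm_submatrix, h8, h6, rhoMax_kron_rot h1 h2 h3, ← Finset.prod_pow,
    ← Finset.prod_inv_distrib]
  refine Finset.prod_congr rfl fun k _ => ?_
  rw [sq_abs, sq_abs, div_pow]
  have := h1 k
  field_simp
  linear_combination h2 k

end GrowthFactors

theorem theorem2p1 (n : ℕ)
    {Ω : Type*} [MeasurableSpace Ω] (μ : Measure Ω) [IsProbabilityMeasure μ]
    -- a Haar-butterfly matrix
    (B : Ω → Matrix (Fin (2 ^ n)) (Fin (2 ^ n)) ℝ) (hB : HasLaw B (haarButterfly n) μ)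
    -- iid Cauchy variables
    {Ω₁ : Type*} [MeasurableSpace Ω₁] (μ₁ : Measure Ω₁) [IsProbabilityMeasure μ₁]
    (X : Fin n → Ω₁ → ℝ) (hX : ∀ j, HasLaw (X j) (cauchyMeasure 0 1) μ₁) (hXi : iIndepFun X μ₁)
    -- iid absolute Cauchy variables conditioned on being at most one
    {Ω₂ : Type*} [MeasurableSpace Ω₂] (μ₂ : Measure Ω₂) [IsProbabilityMeasure μ₂]
    (Y : Fin n → Ω₂ → ℝ) (hY : ∀ j, HasLaw (Y j) condAbsCauchy μ₂) (hYi : iIndepFun Y μ₂) :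
    -- almost surely there is an LU factorization without pivoting
    (∀ᵐ ω ∂μ, GENPDefined (B ω) ∧ IsLU (B ω) (genpL (B ω)) (genpU (B ω))) ∧
    -- almost surely the GEPP factors are unique, and they are the (unique) GERP factors
    (∀ᵐ ω ∂μ, ∃ P L U, IsLU (P * B ω) L U ∧
      (∀ P' Q' L' U', PivotStrategy.partialPivoting.Factors (B ω) P' Q' L' U' ↔
        P' = P ∧ Q' = 1 ∧ L' = L ∧ U' = U) ∧
      (∀ P' Q' L' U', PivotStrategy.rookPivoting.Factors (B ω) P' Q' L' U' ↔
        P' = P ∧ Q' = 1 ∧ L' = L ∧ U' = U)) ∧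
    -- the laws of the growth factors without pivoting
    IdentDistrib (fun ω => rhoMax (B ω)) (fun ω => ∏ j, (1 + |X j ω| ^ 2)) μ μ₁ ∧
    IdentDistrib (fun ω => rhoO (B ω))
      (fun ω => ∏ j, (1 + 2 * |X j ω| ^ 2 / (1 + |X j ω|))) μ μ₁ ∧
    IdentDistrib (fun ω => rhoInf (B ω)) (fun ω => ∏ j, (1 + max |X j ω| (|X j ω| ^ 2))) μ μ₁ ∧
    -- the laws of the growth factors with pivoting, however ties are broken
    (∀ (s : PivotStrategy) (p : Ω → Fin (2 ^ n) → Fin (2 ^ n) × Fin (2 ^ n)),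
      (∀ᵐ ω ∂μ, s.IsRun (B ω) (p ω)) →
      IdentDistrib (fun ω => rhoMax (pivoted (B ω) (p ω))) (fun ω => ∏ j, (1 + Y j ω ^ 2)) μ μ₂ ∧
      IdentDistrib (fun ω => rhoO (pivoted (B ω) (p ω)))
        (fun ω => ∏ j, (1 + 2 * Y j ω ^ 2 / (1 + Y j ω))) μ μ₂ ∧
      IdentDistrib (fun ω => rhoInf (pivoted (B ω) (p ω)))
        (fun ω => ∏ j, (1 + max (Y j ω) (Y j ω ^ 2))) μ μ₂) ∧
    -- inequalities without pivoting
    (∀ᵐ ω ∂μ, 1 ≤ rhoMax (B ω) ∧ rhoMax (B ω) ≤ rhoInf (B ω) ∧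
      1 ≤ rhoO (B ω) ∧ rhoO (B ω) ≤ rhoInf (B ω)) ∧
    -- inequalities with pivoting
    (∀ s : PivotStrategy, ∀ᵐ ω ∂μ, ∀ p, s.IsRun (B ω) p →
      1 ≤ rhoMax (pivoted (B ω) p) ∧
      rhoMax (pivoted (B ω) p) ≤ rhoO (pivoted (B ω) p) ∧
      rhoO (pivoted (B ω) p) ≤ rhoInf (pivoted (B ω) p) ∧
      rhoInf (pivoted (B ω) p) ≤ 2 ^ n) ∧
    -- the GEPP max-norm growth factor is minimal among all row and column permutations
    (∀ᵐ ω ∂μ, ∀ p, PivotStrategy.partialPivoting.IsRun (B ω) p →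
      ∀ σ τ : Equiv.Perm (Fin (2 ^ n)),
        GENPDefined (σ.permMatrix ℝ * B ω * τ.permMatrix ℝ) →
        rhoMax (pivoted (B ω) p) ≤ rhoMax (σ.permMatrix ℝ * B ω * τ.permMatrix ℝ)) := by
  have hgen : ∀ᵐ ω ∂μ, ∃ θ, (∀ k, IsGenericAngle (θ k)) ∧ B ω = butterfly n θ :=
    ae_of_ae_map hB.aemeasurable (by rw [hB.map_eq]; exact ae_haarButterfly n)
  -- The probability space carries `B` but no angles, so the tangents are read off from `B`.
  obtain ⟨T, hTm, hT⟩ := exists_measurable_abs_tan n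
  have hTB : HasLaw (fun ω => T (B ω)) (Measure.pi fun _ => absCauchy) μ :=
    (hasLaw_abs_tan hTm hT).fun_comp hB
  have hTB' : HasLaw (fun ω k => min (T (B ω) k) (T (B ω) k)⁻¹)
      (Measure.pi fun _ => condAbsCauchy) μ := (hasLaw_min_inv n).fun_comp hTB
  have hXl : HasLaw (fun ω j => |X j ω|) (Measure.pi fun _ => absCauchy) μ₁ := by
    refine iIndepFun.hasLaw_pi (X := fun j ω => |X j ω|) (fun j => ?_)
      (hXi.comp (fun _ x => |x|) fun _ => by fun_prop)
    have habs : HasLaw (fun x : ℝ => |x|) absCauchy (cauchyMeasure 0 1) :=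
      ⟨by fun_prop, rfl⟩
    exact habs.fun_comp (hX j)
  have hYl : HasLaw (fun ω j => Y j ω) (Measure.pi fun _ => condAbsCauchy) μ₂ :=
    hYi.hasLaw_pi hY
  have hf1 : Measurable fun y : Fin n → ℝ => ∏ k, (1 + y k ^ 2) := by fun_prop
  have hf2 : Measurable fun y : Fin n → ℝ => ∏ k, (1 + 2 * y k ^ 2 / (1 + y k)) := by fun_prop
  have hf3 : Measurable fun y : Fin n → ℝ => ∏ k, (1 + max (y k) (y k ^ 2)) := by fun_prop
  have hgrow : ∀ᵐ ω ∂μ, rhoMax (B ω) = ∏ k, (1 + T (B ω) k ^ 2) ∧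
      rhoO (B ω) = ∏ k, (1 + 2 * T (B ω) k ^ 2 / (1 + T (B ω) k)) ∧
      rhoInf (B ω) = ∏ k, (1 + max (T (B ω) k) (T (B ω) k ^ 2)) := by
    filter_upwards [hgen] with ω ⟨θ, hθ, hω⟩
    rw [hω, hT θ fun k => (hθ k).cos_ne_zero]
    exact growthFactors_butterfly hθ
  have hTnn : ∀ᵐ ω ∂μ, ∀ k, 0 ≤ T (B ω) k := by
    filter_upwards [hgen] with ω ⟨θ, hθ, hω⟩ k
    rw [hω, hT θ fun k => (hθ k).cos_ne_zero]
    exact abs_nonneg _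
  have hpgrow : ∀ᵐ ω ∂μ, ∀ (s : PivotStrategy) (p), s.IsRun (B ω) p →
      rhoMax (pivoted (B ω) p) = ∏ k, (1 + min (T (B ω) k) (T (B ω) k)⁻¹ ^ 2) ∧
      rhoO (pivoted (B ω) p) = ∏ k, (1 + 2 * min (T (B ω) k) (T (B ω) k)⁻¹ ^ 2 /
        (1 + min (T (B ω) k) (T (B ω) k)⁻¹)) ∧
      rhoInf (pivoted (B ω) p) = ∏ k, (1 + max (min (T (B ω) k) (T (B ω) k)⁻¹)
        (min (T (B ω) k) (T (B ω) k)⁻¹ ^ 2)) := by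
    filter_upwards [hgen] with ω ⟨θ, hθ, hω⟩ s p hp
    rw [hω] at hp ⊢
    exact growthFactors_pivoted_butterfly hθ hp
      fun k => by rw [hT θ fun k => (hθ k).cos_ne_zero]
  refine ⟨?_, ?_, ?_, ?_, ?_, ?_, ?_, ?_, ?_⟩
  · filter_upwards [hgen] with ω ⟨θ, hθ, hω⟩
    rw [hω]
    exact isLU_butterfly hθ
  · filter_upwards [hgen] with ω ⟨θ, hθ, hω⟩
    rw [hω]
    obtain ⟨σ, a, b, ε, h1, h2, h3, h4, -, h6⟩ := exists_submatrix_butterfly_eq hθ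
    have hd := isDominantLU_kron_rot h1 h2 h3 h4
    rw [← h6] at hd
    exact ⟨_, _, _, (permMatrix_mul_eq_submatrix _ σ).symm ▸ hd.toIsLU, hd.factors_iff _,
      hd.factors_iff _⟩
  · exact identDistrib_of_hasLaw hTB hXl hf1 (hgrow.mono fun ω h => h.1)
  · exact identDistrib_of_hasLaw hTB hXl hf2 (hgrow.mono fun ω h => h.2.1)
  · exact identDistrib_of_hasLaw hTB hXl hf3 (hgrow.mono fun ω h => h.2.2)
  · intro s p hp
    -- The choice `p` need not be measurable: almost surely the growth factors do not depend on it.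
    have h := hpgrow.and hp
    exact ⟨identDistrib_of_hasLaw hTB' hYl hf1 (h.mono fun ω h => (h.1 s _ h.2).1),
      identDistrib_of_hasLaw hTB' hYl hf2 (h.mono fun ω h => (h.1 s _ h.2).2.1),
      identDistrib_of_hasLaw hTB' hYl hf3 (h.mono fun ω h => (h.1 s _ h.2).2.2)⟩
  · filter_upwards [hgrow, hTnn] with ω ⟨h1, h2, h3⟩ h4
    exact growthFactors_le_of_eq h4 h1 h2 h3
  · intro s
    filter_upwards [hpgrow, hTnn] with ω h h4 p hp
    obtain ⟨h1, h2, h3⟩ := h s p hp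
    have h5 : ∀ k, 0 ≤ min (T (B ω) k) (T (B ω) k)⁻¹ :=
      fun k => le_min (h4 k) (inv_nonneg.2 (h4 k))
    obtain ⟨h6, -, -, h7⟩ := growthFactors_le_of_eq h5 h1 h2 h3
    obtain ⟨h8, h9⟩ := growthFactors_le_of_eq_of_le_one h5 (fun k => min_inv_le_one) h1 h2 h3
    exact ⟨h6, h8, h7, h9⟩
  · filter_upwards [hgen] with ω ⟨θ, hθ, hω⟩ p hp σ τ hdef
    rw [hω] at hp hdef ⊢
    exact rhoMax_pivoted_butterfly_le hθ hp σ τ hdef
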